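/- **Setting.** Let $\Omega\subset\mathbb R^3$ be open and let $R_1,R_2,R_3:\Omega\to\mathbb R^3$ be $C^1$ vector fields, linearly independent at every point of $\Omega$. Let $L^1,L^2,L^3$ be the rows of $[R_1|R_2|R_3]^{-1}$, put $\Gamma^k_{ij}=L^k(DR_j)R_i$, and let $r_i$ denote differentiation along $R_i$. A solution of the *$\lambda$-system* on an open set $U\subset\Omega$ is a differentiable map $\lambda=(\lambda^1,\lambda^2,\lambda^3):U\to\mathbb R^3$ such that on $U$ (no summation) $$r_i(\lambda^j)=\Gamma^j_{ji}(\lambda^i-\lambda^j)\quad (i\ne j),\qquad (\lambda^i-\lambda^k)\Gamma^k_{ji}=(\lambda^j-\lambda^k)\Gamma^k_{ij}\quad (i<j,\ i\neq k,\ j\ne k).$$ The second (algebraic) part reads $N\,(\lambda^2-\lambda^1,\lambda^3-\lambda^1)^T=0$ with $$N=\begin{pmatrix}\Gamma^1_{32}&-\Gamma^1_{23}\\ \Gamma^2_{31}-\Gamma^2_{13}&\Gamma^2_{13}\\ \Gamma^3_{12}&\Gamma^3_{21}-\Gamma^3_{12}\end{pmatrix}.$$ Assume that at every point of $\Omega$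 the matrix $N$ has rank $1$ and the algebraic part is equivalent to a single relation $\alpha_1\lambda^1+\alpha_2\lambda^2+\alpha_3\lambda^3=0$ with $\alpha_1=0$, $\alpha_2\neq0$, $\alpha_3\ne0$ (exactly $\lambda^2$ and $\lambda^3$ occur in it). **Theorem.** 1. If $\Gamma^3_{31}\ne\Gamma^2_{21}$ at every point of $\Omega$, or only on a dense subset of $\Omega$, then on every connected open $U\subset\Omega$ the solutions of the $\lambda$-system are exactly the trivial ones, $\lambda^1=\lambda^2=\lambda^3=$ constant. In particular this holds if the frame is real analytic, $\Omega$ is connected and $\Gamma^3_{31}$ and $\Gamma^2_{21}$ are not the same function on $\Omega$. 2. If the frame is real analytic and $\Gamma^3_{31}=\Gamma^2_{21}$ on $\Omega$, then near each point $\bar u\in\Omega$ the general solution of the $\lambda$-system depends on one arbitrary analytic function of one variable and one arbitrary constant, in the following sense. Let $\gamma$ be any real analytic curve, defined near $0\in\mathbb R$, with $\gamma(0)=\bar u$ and $L^1(\bar u)\cdot\gamma'(0)\neq0$. For every real function $\varphi$ analytic near $0$ and every $c\in\mathbb R$ there is a real analytic solution $\lambda$ on a neighborhood of $\bar u$ with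 $\lambda^1(\gamma(t))=\varphi(t)$ for all $t$ near $0$ and $\lambda^2(\bar u)=c$; and any two solutions defined near $\bar u$ with the same $\lambda^1\circ\gamma$ near $t=0$ and the same value $\lambda^2(\bar u)$ coincide near $\bar u$. 3. Both situations occur: there are real analytic frames on nonempty convex open sets $\Omega\subset\mathbb R^3$ that satisfy the assumptions above with $\Gamma^3_{31}\neq\Gamma^2_{21}$ everywhere on $\Omega$, and others with $\Gamma^3_{31}=\Gamma^2_{21}$ on $\Omega$. -/

import Mathlib

open Filter Topology
open scoped Matrix

noncomputable section

/-- The matrix `R(u) = [R₁(u) | ⋯ | Rₙ(u)]` whose columns are the given vector fields. -/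
def frameMatrix {n : ℕ} (R : Fin n → (Fin n → ℝ) → (Fin n → ℝ)) (u : Fin n → ℝ) :
    Matrix (Fin n) (Fin n) ℝ :=
  Matrix.of fun i j => R j u i

/-- The coframe: `dualCovector R u k` is the `k`-th row `Lᵏ(u)` of `L(u) = R(u)⁻¹`. -/
def dualCovector {n : ℕ} (R : Fin n → (Fin n → ℝ) → (Fin n → ℝ)) (u : Fin n → ℝ) (k : Fin n) :
    Fin n → ℝ :=
  (frameMatrix R u)⁻¹ k

/-- `frameDeriv R i f u = (rᵢ f)(u)`, the derivative of the function `f` along `Rᵢ`. -/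
def frameDeriv {n : ℕ} (R : Fin n → (Fin n → ℝ) → (Fin n → ℝ)) (i : Fin n)
    (f : (Fin n → ℝ) → ℝ) (u : Fin n → ℝ) : ℝ :=
  fderiv ℝ f u (R i u)

/-- `christoffel R k i j u = Γᵏᵢⱼ(u) = Lᵏ (D Rⱼ) Rᵢ`: upper index first, then the lower ones. -/
def christoffel {n : ℕ} (R : Fin n → (Fin n → ℝ) → (Fin n → ℝ)) (k i j : Fin n)
    (u : Fin n → ℝ) : ℝ :=
  dualCovector R u k ⬝ᵥ fderiv ℝ (R j) u (R i u)

/-- The vector fields `R₁, …, Rₙ` are linearly independent at every point of `Ω`. -/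
def IsFrameOn {n : ℕ} (R : Fin n → (Fin n → ℝ) → (Fin n → ℝ)) (Ω : Set (Fin n → ℝ)) : Prop :=
  ∀ u ∈ Ω, LinearIndependent ℝ fun j => R j u

/-- `lam = (λ¹, …, λⁿ)` is a solution on the open set `U` of the `λ`-system of the frame `R`:
`rᵢ(λʲ) = Γʲⱼᵢ (λⁱ - λʲ)` for `i ≠ j`, and
`(λⁱ - λᵏ) Γᵏⱼᵢ = (λʲ - λᵏ) Γᵏᵢⱼ` for `i < j`, `i ≠ k`, `j ≠ k`. -/
structure IsLambdaSolution {n : ℕ} (R : Fin n → (Fin n → ℝ) → (Fin n → ℝ))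
    (U : Set (Fin n → ℝ)) (lam : (Fin n → ℝ) → Fin n → ℝ) : Prop where
  differentiableOn : DifferentiableOn ℝ lam U
  differential : ∀ u ∈ U, ∀ i j : Fin n, i ≠ j →
    frameDeriv R i (fun v => lam v j) u = christoffel R j j i u * (lam u i - lam u j)
  algebraic : ∀ u ∈ U, ∀ i j k : Fin n, i < j → i ≠ k → j ≠ k →
    (lam u i - lam u k) * christoffel R k j i u = (lam u j - lam u k) * christoffel R k i j u

/-- For `n = 3`, the matrix `N(u)` for which the algebraic part of the `λ`-system reads
`N(u) (λ² - λ¹, λ³ - λ¹)ᵀ = 0`. The indices `1, 2, 3` are written `0, 1, 2` here. -/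
def algebraicMatrix (R : Fin 3 → (Fin 3 → ℝ) → (Fin 3 → ℝ)) (u : Fin 3 → ℝ) :
    Matrix (Fin 3) (Fin 2) ℝ :=
  !![christoffel R 0 2 1 u, -christoffel R 0 1 2 u;
     christoffel R 1 2 0 u - christoffel R 1 0 2 u, christoffel R 1 0 2 u;
     christoffel R 2 0 1 u, christoffel R 2 1 0 u - christoffel R 2 0 1 u]

/-- On `Ω` the algebraic part of the `λ`-system has rank one, and is equivalent to a single
relation `α₁ λ¹ + α₂ λ² + α₃ λ³ = 0` in which exactly `λ²` and `λ³` appear: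
`α₁ = 0`, `α₂ ≠ 0`, `α₃ ≠ 0`. -/
def SingleRelationLambda23 (R : Fin 3 → (Fin 3 → ℝ) → (Fin 3 → ℝ)) (Ω : Set (Fin 3 → ℝ)) :
    Prop :=
  ∀ u ∈ Ω, (algebraicMatrix R u).rank = 1 ∧
    ∃ α : Fin 3 → ℝ, α 0 = 0 ∧ α 1 ≠ 0 ∧ α 2 ≠ 0 ∧
      ∀ l : Fin 3 → ℝ, algebraicMatrix R u *ᵥ ![l 1 - l 0, l 2 - l 0] = 0 ↔
        α 0 * l 0 + α 1 * l 1 + α 2 * l 2 = 0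

/-- On every connected open subset of `Ω` the solutions of the `λ`-system are exactly the trivial
ones `λ¹ = ⋯ = λⁿ = constant`. -/
def OnlyTrivialSolutions {n : ℕ} (R : Fin n → (Fin n → ℝ) → (Fin n → ℝ))
    (Ω : Set (Fin n → ℝ)) : Prop :=
  ∀ U : Set (Fin n → ℝ), IsOpen U → IsPreconnected U → U ⊆ Ω →
    ∀ lam : (Fin n → ℝ) → Fin n → ℝ,
      IsLambdaSolution R U lam ↔ ∃ c : ℝ, ∀ u ∈ U, ∀ i, lam u i = c

/-- Near each point `p` of `Ω`, the general solution of the `λ`-system depends on one arbitrary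
(analytic) function of one variable and one arbitrary constant: for every analytic curve `γ`
through `p` that is transverse to `span {R₂, R₃}` at `p`, the values of `λ¹` along `γ` and the value
of `λ²` at `p` can be prescribed arbitrarily, and they determine the solution near `p`. -/
def DependsOnOneFunctionAndOneConstant (R : Fin 3 → (Fin 3 → ℝ) → (Fin 3 → ℝ))
    (Ω : Set (Fin 3 → ℝ)) : Prop :=
  ∀ p ∈ Ω, ∀ γ : ℝ → Fin 3 → ℝ, AnalyticAt ℝ γ 0 → γ 0 = p →
    dualCovector R p 0 ⬝ᵥ deriv γ 0 ≠ 0 →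
    (∀ (φ : ℝ → ℝ) (c : ℝ), AnalyticAt ℝ φ 0 →
      ∃ U : Set (Fin 3 → ℝ), IsOpen U ∧ p ∈ U ∧ U ⊆ Ω ∧
        ∃ lam : (Fin 3 → ℝ) → Fin 3 → ℝ, IsLambdaSolution R U lam ∧ AnalyticOnNhd ℝ lam U ∧
          (∀ᶠ t in 𝓝 0, lam (γ t) 0 = φ t) ∧ lam p 1 = c) ∧
    (∀ U : Set (Fin 3 → ℝ), IsOpen U → p ∈ U → U ⊆ Ω →
      ∀ lam lam' : (Fin 3 → ℝ) → Fin 3 → ℝ,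
        IsLambdaSolution R U lam → IsLambdaSolution R U lam' →
        (∀ᶠ t in 𝓝 0, lam (γ t) 0 = lam' (γ t) 0) → lam p 1 = lam' p 1 →
        ∀ᶠ u in 𝓝 p, lam u = lam' u)

end

/-! Indices are one-based in the comments and zero-based in the code. Equal λ's always satisfy the
algebraic part, so its single relation is λ² = λ³ =: μ; testing it on (0,1,1) gives Γ¹₃₂ = Γ¹₂₃ and
Γ²₃₁ = Γ³₂₁ = 0. With e = λ¹ - μ the system becomes r₁μ = Γ²₂₁ e = Γ³₃₁ e, r₂μ = r₃μ = 0, r₂e =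
-Γ¹₁₂ e, r₃e = -Γ¹₁₃ e. Where the two coefficients differ, e = 0. If this happens on a dense set,
then e = 0 everywhere by continuity and dμ = 0 (`onlyTrivialSolutions_of_dense`). For analytic
frames density follows from the identity theorem.

Suppose the coefficients agree. Then span{R₂,R₃} is involutive, and the flatness of the connection D
(`frameDeriv_christoffel_sub`) supplies the remaining compatibility conditions,
`SingleRelationLambda23.closed` and `SingleRelationLambda23.frameDeriv_common`. Along γ, where λ¹ =
φ, the function μ must solve the scalar equation m' = (L¹·γ') Γ²₂₁ (φ - m), whose initial value is
the free constant c. Flowing from γ along R₂ and then R₃ gives a chart in which μ is extended as a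
constant and e by linear transport (`exists_isAdaptedChart`). The equations not built into this
construction hold because their defects vanish initially and solve homogeneous linear ODEs
(`IsAdaptedChart.eq_zero_of_surface`, `IsAdaptedChart.eq_zero_of_curve`); uniqueness is proved in
the same way.

Analyticity of the solution rests on analyticity of flows (`AnalyticAt.exists_analyticAt_flow`),
obtained from the analytic implicit function theorem in the space of paths. Both cases occur in the
family `shearFrame κ`, where Γ³₃₁ = κ and Γ²₂₁ = 0. -/

/-! ### Analytic dependence of flows on time and initial point. -/

section AnalyticFlow

open scoped unitInterval ContDiff

variable {F : Type*} [NormedAddCommGroup F] [NormedSpace ℝ F]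

/-- A continuous multilinear map acts pointwise on continuous functions. -/
noncomputable def ContinuousMultilinearMap.pointwise {n : ℕ}
    (f : ContinuousMultilinearMap ℝ (fun _ : Fin n => F) F) :
    ContinuousMultilinearMap ℝ (fun _ : Fin n => C(I, F)) C(I, F) :=
  MultilinearMap.mkContinuous
    { toFun := fun y => ⟨fun τ => f fun i => y i τ, by fun_prop⟩
      map_update_add' := by
        intro _ y i a b
        ext τ
        have key : ∀ c : C(I, F), (fun j => Function.update y i c j τ) =
            Function.update (fun j => y j τ) i (c τ) := by
          intro c; ext j; by_cases h : j = i
          · subst h; simp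
          · simp [h]
        simp [key]
      map_update_smul' := by
        intro _ y i r a
        ext τ
        have key : ∀ c : C(I, F), (fun j => Function.update y i c j τ) =
            Function.update (fun j => y j τ) i (c τ) := by
          intro c; ext j; by_cases h : j = i
          · subst h; simp
          · simp [h]
        simp [key] }
    ‖f‖ (by
      intro y
      refine (ContinuousMap.norm_le _ (by positivity)).2 fun τ => ?_
      refine (f.le_opNorm _).trans ?_
      gcongr with i
      exact (y i).norm_coe_le_norm τ)

@[simp] theorem ContinuousMultilinearMap.pointwise_apply {n : ℕ}
    (f : ContinuousMultilinearMap ℝ (fun _ : Fin n => F) F) (y : Fin n → C(I, F)) (τ : I) :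
    f.pointwise y τ = f fun i => y i τ := rfl

theorem ContinuousMultilinearMap.norm_pointwise_le {n : ℕ}
    (f : ContinuousMultilinearMap ℝ (fun _ : Fin n => F) F) : ‖f.pointwise‖ ≤ ‖f‖ :=
  MultilinearMap.mkContinuous_norm_le _ (norm_nonneg f) _

/-- Superposition with a map analytic at `x₀` is analytic at the constant function `x₀`. -/
theorem AnalyticAt.exists_superposition [CompleteSpace F] {X : F → F} {x₀ : F}
    (hX : AnalyticAt ℝ X x₀) :
    ∃ N : C(I, F) → C(I, F), AnalyticAt ℝ N (ContinuousMap.const I x₀) ∧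
      ∀ᶠ y in 𝓝 (ContinuousMap.const I x₀), ∀ τ, N y τ = X (y τ) := by
  obtain ⟨p, r, hp⟩ := hX
  let q : FormalMultilinearSeries ℝ C(I, F) C(I, F) := fun n => (p n).pointwise
  -- Acting pointwise does not increase the norm of a coefficient, so the radius of convergence does
  -- not shrink.
  have hq : p.radius ≤ q.radius := by
    refine ENNReal.le_of_forall_nnreal_lt fun s hs => ?_
    obtain ⟨C, -, hC⟩ := p.norm_mul_pow_le_of_lt_radius hs
    refine q.le_radius_of_bound C fun n => le_trans ?_ (hC n)
    gcongr
    exact (p n).norm_pointwise_le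
  have hr : r ≤ q.radius := hp.r_le.trans hq
  have hq0 := (q.hasFPowerSeriesOnBall (hp.r_pos.trans_le hr)).mono hp.r_pos hr
  have hN := hq0.comp_sub (ContinuousMap.const I x₀)
  rw [zero_add] at hN
  refine ⟨_, hN.analyticAt, ?_⟩
  filter_upwards [Metric.eball_mem_nhds _ hp.r_pos] with y hy τ
  have h1 := hN.hasSum_sub hy
  -- Evaluation at τ is continuous and linear, so it turns the series of paths into the series of X
  -- at y τ.
  have h2 : HasSum (fun n => p n fun _ => y τ - x₀) (q.sum (y - ContinuousMap.const I x₀) τ) := by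
    have := h1.map (ContinuousMap.evalCLM ℝ τ) (ContinuousMap.evalCLM ℝ τ).continuous
    simpa [Function.comp_def, q] using this
  refine h2.unique (hp.hasSum_sub ?_)
  rw [Metric.mem_eball] at hy ⊢
  refine lt_of_le_of_lt ?_ hy
  rw [edist_dist, edist_dist]
  refine ENNReal.ofReal_le_ofReal ?_
  simpa using ContinuousMap.dist_apply_le_dist (f := y) (g := ContinuousMap.const I x₀) τ

/-- The primitive vanishing at `0` of a continuous function on the unit interval. -/
noncomputable def unitIntervalPrimitive (F : Type*) [NormedAddCommGroup F] [NormedSpace ℝ F] :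
    C(I, F) →L[ℝ] C(I, F) :=
  LinearMap.mkContinuous
    { toFun := fun y =>
        -- This is ∫₀^τ y after the substitution r = τ s, a form that makes the scaling behaviour
        -- immediate; `projIcc` only coerces s into the unit interval.
        ⟨fun τ => (τ : ℝ) • ∫ s in (0 : ℝ)..1, y (τ * Set.projIcc 0 1 zero_le_one s), by
          refine Continuous.smul continuous_subtype_val ?_
          refine intervalIntegral.continuous_parametric_intervalIntegral_of_continuous' ?_ 0 1
          have : Continuous (Set.projIcc (0 : ℝ) 1 zero_le_one) := continuous_projIcc
          simp only [Function.uncurry_def]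
          fun_prop⟩
      map_add' := by
        intro y z
        ext τ
        have h : Continuous (Set.projIcc (0 : ℝ) 1 zero_le_one) := continuous_projIcc
        simp only [ContinuousMap.coe_mk, ContinuousMap.add_apply]
        rw [intervalIntegral.integral_add, smul_add]
        · exact Continuous.intervalIntegrable (by fun_prop) _ _
        · exact Continuous.intervalIntegrable (by fun_prop) _ _
      map_smul' := by
        intro c y
        ext τ
        simp only [ContinuousMap.coe_mk, ContinuousMap.smul_apply, RingHom.id_apply,
          intervalIntegral.integral_smul]
        rw [smul_comm] }
    1 (by
      intro y
      refine (ContinuousMap.norm_le _ (by positivity)).2 fun τ => ?_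
      have h : ‖∫ s in (0 : ℝ)..1, y (τ * Set.projIcc 0 1 zero_le_one s)‖ ≤ ‖y‖ := by
        simpa using intervalIntegral.norm_integral_le_of_norm_le_const
          (a := 0) (b := 1) (f := fun s => y (τ * Set.projIcc 0 1 zero_le_one s))
          fun s _ => y.norm_coe_le_norm _
      simp only [LinearMap.coe_mk, AddHom.coe_mk, ContinuousMap.coe_mk, norm_smul]
      have h1 : ‖(τ : ℝ)‖ ≤ 1 := by
        rw [Real.norm_of_nonneg τ.2.1]; exact τ.2.2
      gcongr)

theorem unitIntervalPrimitive_apply (y : C(I, F)) (τ : I) :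
    unitIntervalPrimitive F y τ =
      (τ : ℝ) • ∫ s in (0 : ℝ)..1, y (τ * Set.projIcc 0 1 zero_le_one s) := rfl

/-- The reparametrization `s ↦ y (τ s)`. -/
def ContinuousMap.rescale (y : C(I, F)) (τ : I) : C(I, F) :=
  y.comp ⟨fun s => τ * s, by fun_prop⟩

set_option linter.unusedSectionVars false in
@[simp] theorem ContinuousMap.rescale_apply (y : C(I, F)) (τ s : I) :
    y.rescale τ s = y (τ * s) := rfl

/-- This scaling law turns a solution of the integral equation for time t into one for time tτ. -/
theorem smul_unitIntervalPrimitive_rescale (y : C(I, F)) (τ s : I) :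
    (τ : ℝ) • unitIntervalPrimitive F (y.rescale τ) s = unitIntervalPrimitive F y (τ * s) := by
  simp [unitIntervalPrimitive_apply, mul_assoc, mul_smul]

set_option linter.unusedSectionVars false in
theorem ContinuousMap.dist_rescale_const_le (y : C(I, F)) (τ : I) (x : F) :
    dist (y.rescale τ) (ContinuousMap.const I x) ≤ dist y (ContinuousMap.const I x) := by
  refine (ContinuousMap.dist_le dist_nonneg).2 fun s => ?_
  simpa using ContinuousMap.dist_apply_le_dist (f := y) (g := ContinuousMap.const I x) (τ * s)

/-- An analytic vector field has an analytic local flow. -/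
theorem AnalyticAt.exists_analyticAt_flow [CompleteSpace F] {X : F → F} {x₀ : F}
    (hX : AnalyticAt ℝ X x₀) :
    ∃ Φ : ℝ × F → F, AnalyticAt ℝ Φ (0, x₀) ∧ (∀ᶠ x in 𝓝 x₀, Φ (0, x) = x) ∧
      ∀ᶠ z in 𝓝 ((0 : ℝ), x₀), HasDerivAt (fun s => Φ (s, z.2)) (X (Φ z)) z.1 := by
  obtain ⟨N, hN, hNX⟩ := hX.exists_superposition
  set y₀ : C(I, F) := ContinuousMap.const I x₀
  let J := unitIntervalPrimitive F
  let cst : F →L[ℝ] C(I, F) := LinearMap.mkContinuous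
    { toFun := ContinuousMap.const I, map_add' := fun _ _ => rfl, map_smul' := fun _ _ => rfl } 1
    fun x => by simpa using (ContinuousMap.norm_le _ (norm_nonneg x)).2 fun _ => le_rfl
  have hcst : ∀ x τ, cst x τ = x := fun _ _ => rfl
  -- Zeros of G are the paths y(τ) = x + t ∫₀^τ X(y), that is, integral curves from x with time
  -- rescaled to the unit interval.
  let G : (ℝ × F) × C(I, F) → C(I, F) := fun v => v.2 - cst v.1.2 - v.1.1 • J (N v.2)
  let u : (ℝ × F) × C(I, F) := ((0, x₀), y₀)
  have hG : AnalyticAt ℝ G u := by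
    have h1 : AnalyticAt ℝ (fun v : (ℝ × F) × C(I, F) => N v.2) u :=
      AnalyticAt.comp (g := N) (f := Prod.snd) hN analyticAt_snd
    have h2 : AnalyticAt ℝ (fun v : (ℝ × F) × C(I, F) => J (N v.2)) u :=
      (J.analyticAt _).comp h1
    have h3 : AnalyticAt ℝ (fun v : (ℝ × F) × C(I, F) => v.1.1) u :=
      analyticAt_fst.comp analyticAt_fst
    have h4 : AnalyticAt ℝ (fun v : (ℝ × F) × C(I, F) => cst v.1.2) u :=
      (cst.analyticAt _).comp (analyticAt_snd.comp analyticAt_fst)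
    exact (analyticAt_snd.sub h4).sub (h3.smul h2)
  have hGu : G u = 0 := by
    ext τ
    simp [G, u, y₀, hcst]
  have hGc : ContDiffAt ℝ ω G u := hG.contDiffAt
  have hinv : (fderiv ℝ G u ∘L .inr ℝ (ℝ × F) C(I, F)).IsInvertible := by
    have h1 : HasFDerivAt (fun y => G (u.1, y))
        (fderiv ℝ G u ∘L .inr ℝ (ℝ × F) C(I, F)) u.2 :=
      hG.differentiableAt.hasFDerivAt.comp u.2 (hasFDerivAt_prodMk_right u.1 u.2)
    -- At t = 0 the integral term disappears, so the partial derivative in y is the identity.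
    have h2 : HasFDerivAt (fun y => G (u.1, y)) (ContinuousLinearMap.id ℝ C(I, F)) u.2 := by
      have : (fun y => G (u.1, y)) = fun y => y - cst x₀ := by
        funext y; simp [G, u]
      rw [this]
      exact (hasFDerivAt_id _).sub_const _
    rw [h1.unique h2]
    exact ContinuousLinearMap.isInvertible_equiv (f := ContinuousLinearEquiv.refl ℝ C(I, F))
  let ψ := hGc.implicitFunction (by simp) hinv
  have hψ : ContDiffAt ℝ ω ψ (0, x₀) := hGc.contDiffAt_implicitFunction (by simp) hinv
  have hψ0 : ψ (0, x₀) = y₀ := hGc.implicitFunction_apply_self (by simp) hinv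
  have hψG : ∀ᶠ z in 𝓝 ((0 : ℝ), x₀), G (z, ψ z) = 0 := by
    have := hGc.eventually_apply_implicitFunction (by simp) hinv
    simpa [hGu] using this
  have hψu : ∀ᶠ v in 𝓝 u, G v = 0 ↔ ψ v.1 = v.2 := by
    have := hGc.eventually_apply_eq_iff_implicitFunction (by simp) hinv
    simpa [hGu] using this
  have hψA : AnalyticAt ℝ ψ (0, x₀) := hψ.analyticAt
  have hψt : Tendsto ψ (𝓝 (0, x₀)) (𝓝 y₀) := by
    simpa [hψ0] using hψA.continuousAt.tendsto
  -- self-similarity of the solution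
  have hself : ∀ᶠ z in 𝓝 ((0 : ℝ), x₀), ∀ τ : I, ψ (z.1 * τ, z.2) = (ψ z).rescale τ := by
    obtain ⟨ε, hε, hball⟩ := Metric.eventually_nhds_iff.1
      (hψu.and ((continuous_snd.tendsto u).eventually hNX))
    have hnear : ∀ᶠ z in 𝓝 ((0 : ℝ), x₀), dist (z, ψ z) u < ε :=
      (continuousAt_id.prodMk hψA.continuousAt).tendsto.eventually
        (by simpa [u, hψ0] using Metric.eventually_nhds_iff_ball.2 ⟨ε, hε, fun _ h => h⟩)
    filter_upwards [hnear, hψG] with z hz hGz τ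
    -- Rescaling does not increase the distance to the base point, so the local uniqueness of the
    -- implicit function still applies.
    have hτ : dist ((z.1 * τ, z.2), (ψ z).rescale τ) u < ε := by
      refine lt_of_le_of_lt ?_ hz
      simp only [Prod.dist_eq, u]
      refine max_le_max (max_le_max ?_ le_rfl) ((ψ z).dist_rescale_const_le τ x₀)
      simp only [Real.dist_eq, sub_zero, abs_mul]
      refine mul_le_of_le_one_right (abs_nonneg _) ?_
      rw [abs_of_nonneg τ.2.1]; exact τ.2.2
    have hNz := (hball hz).2
    have hNτ := (hball hτ).2
    have hres : N ((ψ z).rescale τ) = (N (ψ z)).rescale τ := by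
      ext s
      rw [hNτ, ContinuousMap.rescale_apply, ContinuousMap.rescale_apply, hNz]
    refine (hball hτ).1.1 ?_
    ext s
    have h := congrArg (fun y : C(I, F) => y (τ * s)) hGz
    simp only [G, ContinuousMap.sub_apply, ContinuousMap.smul_apply, ContinuousMap.zero_apply,
      hres, mul_smul] at h ⊢
    rw [smul_unitIntervalPrimitive_rescale]
    simpa [hcst] using h
  -- The equation at τ = 1; self-similarity replaces the interior values of the path by endpoints of
  -- shorter flows.
  have hint : ∀ᶠ z in 𝓝 ((0 : ℝ), x₀),
      ψ z 1 = z.2 + z.1 • ∫ s in (0 : ℝ)..1, X (ψ (z.1 * s, z.2) 1) := by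
    filter_upwards [hself, hψG, hψt.eventually hNX] with z hz hGz hNz
    have h := congrArg (fun y : C(I, F) => y 1) hGz
    simp only [G, ContinuousMap.sub_apply, ContinuousMap.smul_apply, ContinuousMap.zero_apply, J,
      unitIntervalPrimitive_apply] at h
    have h2 : ∫ s in (0 : ℝ)..1, N (ψ z) (1 * Set.projIcc 0 1 zero_le_one s) =
        ∫ s in (0 : ℝ)..1, X (ψ (z.1 * s, z.2) 1) := by
      refine intervalIntegral.integral_congr fun s hs => ?_
      rw [Set.uIcc_of_le zero_le_one] at hs
      simp only [hNz]
      rw [one_mul, Set.projIcc_of_mem _ hs, hz ⟨s, hs⟩]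
      simp
    rw [h2] at h
    simp only [Set.Icc.coe_one, one_smul] at h
    rw [sub_sub, sub_eq_zero] at h
    simpa [hcst] using h
  let Φ : ℝ × F → F := fun z => ψ z 1
  have hΦ : AnalyticAt ℝ Φ (0, x₀) :=
    ((ContinuousMap.evalCLM ℝ (1 : I) : C(I, F) →L[ℝ] F).analyticAt _).comp hψA
  have hΦ0 : Φ (0, x₀) = x₀ := by simp [Φ, hψ0, y₀]
  have hXΦ : AnalyticAt ℝ (fun z => X (Φ z)) (0, x₀) :=
    AnalyticAt.comp (g := X) (f := Φ) (by rwa [hΦ0]) hΦ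
  refine ⟨Φ, hΦ, ?_, ?_⟩
  · have := (Continuous.prodMk_right (X := ℝ) (Y := F) 0).tendsto x₀ |>.eventually hint
    filter_upwards [this] with x hx
    simpa [Φ] using hx
  · obtain ⟨ε, hε, hball⟩ := Metric.eventually_nhds_iff.1
      (hint.and hXΦ.eventually_continuousAt)
    refine Metric.eventually_nhds_iff.2 ⟨ε, hε, fun z hz => ?_⟩
    have hmem : ∀ s ∈ Metric.ball (0 : ℝ) ε, dist (s, z.2) ((0 : ℝ), x₀) < ε := by
      intro s hs
      rw [Prod.dist_eq] at hz ⊢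
      exact max_lt hs ((le_max_right _ _).trans_lt hz)
    have hz1 : z.1 ∈ Metric.ball (0 : ℝ) ε := by
      rw [Prod.dist_eq] at hz
      exact (le_max_left _ _).trans_lt hz
    have hcont : ContinuousOn (fun s => X (Φ (s, z.2))) (Metric.ball (0 : ℝ) ε) := by
      intro s hs
      have h1 := (hball (hmem s hs)).2
      exact (ContinuousAt.comp (g := fun z => X (Φ z)) (f := fun s => (s, z.2)) h1
        (by fun_prop)).continuousWithinAt
    have hformula : ∀ s ∈ Metric.ball (0 : ℝ) ε,
        Φ (s, z.2) = z.2 + ∫ r in (0 : ℝ)..s, X (Φ (r, z.2)) := by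
      intro s hs
      have h1 := (hball (hmem s hs)).1
      have h2 := intervalIntegral.smul_integral_comp_mul_left (a := 0) (b := 1)
        (fun r => X (Φ (r, z.2))) s
      simp only [mul_zero, mul_one] at h2
      rw [← h2]
      exact h1
    have hsub : Set.uIcc 0 z.1 ⊆ Metric.ball (0 : ℝ) ε := by
      rw [Real.ball_eq_Ioo] at hz1 ⊢
      exact Set.OrdConnected.uIcc_subset Set.ordConnected_Ioo (by simp [hε]) hz1
    have hd := intervalIntegral.integral_hasDerivAt_right
      ((hcont.mono hsub).intervalIntegrable)
      (hcont.stronglyMeasurableAtFilter Metric.isOpen_ball _ hz1)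
      (hcont.continuousAt (Metric.isOpen_ball.mem_nhds hz1))
    refine (hd.const_add z.2).congr_of_eventuallyEq ?_
    filter_upwards [Metric.isOpen_ball.mem_nhds hz1] with s hs using hformula s hs

end AnalyticFlow

/-! ### Commutators and curvature identities in a moving frame. -/

section FrameCalculus

variable {n : ℕ} {R : Fin n → (Fin n → ℝ) → (Fin n → ℝ)} {u : Fin n → ℝ}

theorem isUnit_frameMatrix (h : LinearIndependent ℝ fun j => R j u) :
    IsUnit (frameMatrix R u) :=
  Matrix.linearIndependent_cols_iff_isUnit.1 h

theorem dualCovector_dotProduct_frame (h : LinearIndependent ℝ fun j => R j u) (k j : Fin n) :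
    dualCovector R u k ⬝ᵥ R j u = if k = j then 1 else 0 := by
  have h1 := Matrix.nonsing_inv_mul _ ((Matrix.isUnit_iff_isUnit_det _).1 (isUnit_frameMatrix h))
  have h2 := congrFun (congrFun h1 k) j
  rw [Matrix.mul_apply, Matrix.one_apply] at h2
  exact h2

theorem sum_dualCovector_smul_frame (h : LinearIndependent ℝ fun j => R j u) (v : Fin n → ℝ) :
    ∑ k, (dualCovector R u k ⬝ᵥ v) • R k u = v := by
  have h1 := Matrix.mul_nonsing_inv _ ((Matrix.isUnit_iff_isUnit_det _).1 (isUnit_frameMatrix h))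
  have h2 := congrArg (fun M : Matrix (Fin n) (Fin n) ℝ => M *ᵥ v) h1
  simp only [← Matrix.mulVec_mulVec, Matrix.one_mulVec] at h2
  ext a
  have h3 := congrFun h2 a
  simp only [Matrix.mulVec, dotProduct] at h3
  simp only [Finset.sum_apply, Pi.smul_apply, smul_eq_mul, dualCovector, dotProduct]
  rw [← h3]
  exact Finset.sum_congr rfl fun k _ => mul_comm _ _

theorem fderiv_frame_eq_sum (h : LinearIndependent ℝ fun j => R j u) (i j : Fin n) :
    fderiv ℝ (R j) u (R i u) = ∑ k, christoffel R k i j u • R k u :=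
  (sum_dualCovector_smul_frame h _).symm

/-- The expansion of a directional derivative in the frame. -/
theorem fderiv_eq_sum_frameDeriv (h : LinearIndependent ℝ fun j => R j u)
    (f : (Fin n → ℝ) → ℝ) (v : Fin n → ℝ) :
    fderiv ℝ f u v = ∑ k, (dualCovector R u k ⬝ᵥ v) * frameDeriv R k f u := by
  conv_lhs => rw [← sum_dualCovector_smul_frame h v]
  simp [frameDeriv]

theorem fderiv_eq_zero_of_frameDeriv (h : LinearIndependent ℝ fun j => R j u)
    {f : (Fin n → ℝ) → ℝ} (hf : ∀ k, frameDeriv R k f u = 0) : fderiv ℝ f u = 0 := by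
  ext1 v
  rw [fderiv_eq_sum_frameDeriv h]
  simp [hf]

theorem analyticAt_det {E : Type*} [NormedAddCommGroup E] [NormedSpace ℝ E] {x : E}
    {M : E → Matrix (Fin n) (Fin n) ℝ} (hM : ∀ i j, AnalyticAt ℝ (fun v => M v i j) x) :
    AnalyticAt ℝ (fun v => (M v).det) x := by
  simp only [Matrix.det_apply']
  refine Finset.analyticAt_fun_sum _ fun σ _ => analyticAt_const.fun_mul ?_
  exact Finset.analyticAt_fun_prod _ fun i _ => hM (σ i) i

theorem analyticAt_frameMatrix_det (hR : ∀ i, AnalyticAt ℝ (R i) u) :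
    AnalyticAt ℝ (fun v => (frameMatrix R v).det) u :=
  analyticAt_det fun i j => analyticAt_pi_iff.1 (hR j) i

theorem analyticAt_frameMatrix_adjugate (hR : ∀ i, AnalyticAt ℝ (R i) u) (a b : Fin n) :
    AnalyticAt ℝ (fun v => (frameMatrix R v).adjugate a b) u := by
  simp only [Matrix.adjugate_apply]
  refine analyticAt_det fun i j => ?_
  by_cases hi : i = b
  · subst hi; simpa using analyticAt_const
  · simpa [Matrix.updateRow_ne hi, frameMatrix] using analyticAt_pi_iff.1 (hR j) i

/-- Cramer's rule: the inverse is the adjugate divided by a nonvanishing determinant. -/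
theorem analyticAt_dualCovector (hR : ∀ i, AnalyticAt ℝ (R i) u)
    (h : LinearIndependent ℝ fun j => R j u) (k : Fin n) :
    AnalyticAt ℝ (fun v => dualCovector R v k) u := by
  refine AnalyticAt.pi fun a => ?_
  have hd : (frameMatrix R u).det ≠ 0 :=
    ((Matrix.isUnit_iff_isUnit_det _).1 (isUnit_frameMatrix h)).ne_zero
  have := ((analyticAt_frameMatrix_det hR).inv hd).mul (analyticAt_frameMatrix_adjugate hR k a)
  refine this.congr (Eventually.of_forall fun v => ?_)
  simp [dualCovector, Matrix.inv_def]

theorem AnalyticAt.dotProduct {E : Type*} [NormedAddCommGroup E] [NormedSpace ℝ E] {x : E}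
    {f g : E → Fin n → ℝ} (hf : AnalyticAt ℝ f x) (hg : AnalyticAt ℝ g x) :
    AnalyticAt ℝ (fun v => f v ⬝ᵥ g v) x :=
  Finset.analyticAt_fun_sum _ fun a _ => (analyticAt_pi_iff.1 hf a).mul (analyticAt_pi_iff.1 hg a)

theorem AnalyticAt.fderiv_apply {E G : Type*} [NormedAddCommGroup E] [NormedSpace ℝ E]
    [CompleteSpace E]
    [NormedAddCommGroup G] [NormedSpace ℝ G] [CompleteSpace G] {x : E} {f : E → G} {X : E → E}
    (hf : AnalyticAt ℝ f x) (hX : AnalyticAt ℝ X x) :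
    AnalyticAt ℝ (fun v => fderiv ℝ f v (X v)) x :=
  -- The exponent `⊤` is the analytic class, from which analyticity can be read back.
  ((hf.fderiv.contDiffAt (n := ⊤)).clm_apply (hX.contDiffAt (n := ⊤))).analyticAt

theorem analyticAt_christoffel (hR : ∀ i, AnalyticAt ℝ (R i) u)
    (h : LinearIndependent ℝ fun j => R j u) (k i j : Fin n) :
    AnalyticAt ℝ (christoffel R k i j) u :=
  (analyticAt_dualCovector hR h k).dotProduct ((hR j).fderiv_apply (hR i))

theorem analyticAt_frameDeriv (hR : ∀ i, AnalyticAt ℝ (R i) u) {f : (Fin n → ℝ) → ℝ}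
    (hf : AnalyticAt ℝ f u) (i : Fin n) : AnalyticAt ℝ (frameDeriv R i f) u :=
  hf.fderiv_apply (hR i)

theorem eventually_linearIndependent (hR : ∀ i, AnalyticAt ℝ (R i) u)
    (h : LinearIndependent ℝ fun j => R j u) :
    ∀ᶠ v in 𝓝 u, LinearIndependent ℝ fun j => R j v := by
  have hd : (frameMatrix R u).det ≠ 0 :=
    ((Matrix.isUnit_iff_isUnit_det _).1 (isUnit_frameMatrix h)).ne_zero
  filter_upwards [(analyticAt_frameMatrix_det hR).continuousAt.eventually_ne hd] with v hv
  exact Matrix.linearIndependent_cols_iff_isUnit.2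
    ((Matrix.isUnit_iff_isUnit_det _).2 (isUnit_iff_ne_zero.2 hv))

theorem fderiv_fderiv_apply {E G : Type*} [NormedAddCommGroup E] [NormedSpace ℝ E]
    [NormedAddCommGroup G] [NormedSpace ℝ G] [CompleteSpace G] {x : E} {f : E → G} {X : E → E}
    (hf : AnalyticAt ℝ f x) (hX : DifferentiableAt ℝ X x) (w : E) :
    fderiv ℝ (fun v => fderiv ℝ f v (X v)) x w =
      fderiv ℝ (fderiv ℝ f) x w (X x) + fderiv ℝ f x (fderiv ℝ X x w) := by
  rw [fderiv_clm_apply hf.fderiv.differentiableAt hX]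
  simp [add_comm]

/-- The commutator of two frame derivatives. -/
theorem frameDeriv_frameDeriv_sub (hR : ∀ i, AnalyticAt ℝ (R i) u)
    (h : LinearIndependent ℝ fun j => R j u) {f : (Fin n → ℝ) → ℝ} (hf : AnalyticAt ℝ f u)
    (i j : Fin n) :
    frameDeriv R i (frameDeriv R j f) u - frameDeriv R j (frameDeriv R i f) u =
      ∑ k, (christoffel R k i j u - christoffel R k j i u) * frameDeriv R k f u := by
  have key : ∀ a b, frameDeriv R a (frameDeriv R b f) u =
      fderiv ℝ (fderiv ℝ f) u (R a u) (R b u) +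
        ∑ k, christoffel R k a b u * frameDeriv R k f u := by
    intro a b
    have h1 := fderiv_fderiv_apply hf (hR b).differentiableAt (R a u)
    rw [fderiv_eq_sum_frameDeriv h f] at h1
    exact h1
  have hs : IsSymmSndFDerivAt ℝ f u := (hf.contDiffAt (n := ⊤)).isSymmSndFDerivAt_of_omega
  rw [key, key, hs.eq (R i u) (R j u)]
  simp [sub_mul, Finset.sum_sub_distrib]

/-- Differentiate DRⱼ(Rᵢ) = Σ Γˡᵢⱼ Rₗ along Rₘ. The second-derivative term is symmetric in m and i,
so it cancels on antisymmetrizing. -/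
theorem frameDeriv_christoffel (hR : ∀ i, AnalyticAt ℝ (R i) u)
    (h : LinearIndependent ℝ fun j => R j u) (m i j k : Fin n) :
    frameDeriv R m (christoffel R k i j) u + ∑ l, christoffel R l i j u * christoffel R k m l u =
      dualCovector R u k ⬝ᵥ fderiv ℝ (fderiv ℝ (R j)) u (R m u) (R i u) +
        ∑ s, christoffel R s m i u * christoffel R k s j u := by
  have h1 := fderiv_fderiv_apply (hR j) (hR i).differentiableAt (R m u)
  have h2 : (fun v => fderiv ℝ (R j) v (R i v)) =ᶠ[𝓝 u]
      fun v => ∑ l, christoffel R l i j v • R l v := by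
    filter_upwards [eventually_linearIndependent hR h] with v hv using fderiv_frame_eq_sum hv i j
  rw [h2.fderiv_eq, fderiv_fun_sum fun l _ =>
    (analyticAt_christoffel hR h l i j).differentiableAt.fun_smul (hR l).differentiableAt,
    sum_apply] at h1
  have h3 := congrArg (fun w => dualCovector R u k ⬝ᵥ w) h1
  have h4 : ∀ l, fderiv ℝ (fun v => christoffel R l i j v • R l v) u (R m u) =
      christoffel R l i j u • fderiv ℝ (R l) u (R m u) +
        frameDeriv R m (christoffel R l i j) u • R l u := by
    intro l
    rw [fderiv_fun_smul (analyticAt_christoffel hR h l i j).differentiableAt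
      (hR l).differentiableAt]
    simp [frameDeriv]
  simp only [h4, fderiv_frame_eq_sum h m i, map_sum, map_smul, dotProduct_add, dotProduct_sum,
    dotProduct_smul, Finset.sum_add_distrib, dualCovector_dotProduct_frame h, smul_eq_mul,
    mul_ite, mul_one, mul_zero, Finset.sum_ite_eq, Finset.mem_univ, if_true] at h3
  rw [add_comm]
  exact h3

/-- The vanishing of the curvature of the flat connection, in terms of the frame. -/
theorem frameDeriv_christoffel_sub (hR : ∀ i, AnalyticAt ℝ (R i) u)
    (h : LinearIndependent ℝ fun j => R j u) (m i j k : Fin n) :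
    frameDeriv R m (christoffel R k i j) u - frameDeriv R i (christoffel R k m j) u =
      ∑ l, (christoffel R l m j u * christoffel R k i l u -
        christoffel R l i j u * christoffel R k m l u +
        (christoffel R l m i u - christoffel R l i m u) * christoffel R k l j u) := by
  have h1 := frameDeriv_christoffel hR h m i j k
  have h2 := frameDeriv_christoffel hR h i m j k
  have hs : IsSymmSndFDerivAt ℝ (R j) u :=
    ((hR j).contDiffAt (n := ⊤)).isSymmSndFDerivAt_of_omega
  rw [hs.eq (R m u) (R i u)] at h1
  simp only [Finset.sum_add_distrib, Finset.sum_sub_distrib, sub_mul]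
  linarith

theorem frameDeriv_add {f g : (Fin n → ℝ) → ℝ} (hf : DifferentiableAt ℝ f u)
    (hg : DifferentiableAt ℝ g u) (i : Fin n) :
    frameDeriv R i (fun v => f v + g v) u = frameDeriv R i f u + frameDeriv R i g u := by
  simp [frameDeriv, fderiv_fun_add hf hg]

theorem frameDeriv_sub {f g : (Fin n → ℝ) → ℝ} (hf : DifferentiableAt ℝ f u)
    (hg : DifferentiableAt ℝ g u) (i : Fin n) :
    frameDeriv R i (fun v => f v - g v) u = frameDeriv R i f u - frameDeriv R i g u := by
  simp [frameDeriv, fderiv_fun_sub hf hg]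

theorem frameDeriv_mul {f g : (Fin n → ℝ) → ℝ} (hf : DifferentiableAt ℝ f u)
    (hg : DifferentiableAt ℝ g u) (i : Fin n) :
    frameDeriv R i (fun v => f v * g v) u =
      frameDeriv R i f u * g u + f u * frameDeriv R i g u := by
  simp [frameDeriv, fderiv_fun_mul hf hg]
  ring

theorem frameDeriv_congr {f g : (Fin n → ℝ) → ℝ} (hfg : f =ᶠ[𝓝 u] g) (i : Fin n) :
    frameDeriv R i f u = frameDeriv R i g u := by
  rw [frameDeriv, frameDeriv, hfg.fderiv_eq]

theorem frameDeriv_eq_zero {f : (Fin n → ℝ) → ℝ} (hf : ∀ᶠ v in 𝓝 u, f v = 0) (i : Fin n) :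
    frameDeriv R i f u = 0 := by
  rw [frameDeriv_congr (g := fun _ => 0) hf]
  simp [frameDeriv]

end FrameCalculus

/-! ### Reduction to λ² = λ³, and the case of distinct coefficients. -/

section Algebra

variable {R : Fin 3 → (Fin 3 → ℝ) → (Fin 3 → ℝ)} {Ω U : Set (Fin 3 → ℝ)} {u : Fin 3 → ℝ}
  {lam : (Fin 3 → ℝ) → Fin 3 → ℝ}

theorem algebraicMatrix_mulVec_eq_zero_iff (l : Fin 3 → ℝ) :
    algebraicMatrix R u *ᵥ ![l 1 - l 0, l 2 - l 0] = 0 ↔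
      (l 1 - l 0) * christoffel R 0 2 1 u = (l 2 - l 0) * christoffel R 0 1 2 u ∧
      (l 0 - l 1) * christoffel R 1 2 0 u = (l 2 - l 1) * christoffel R 1 0 2 u ∧
      (l 0 - l 2) * christoffel R 2 1 0 u = (l 1 - l 2) * christoffel R 2 0 1 u := by
  rw [funext_iff, Fin.forall_fin_succ, Fin.forall_fin_two]
  simp only [algebraicMatrix, Matrix.mulVec, dotProduct, Fin.sum_univ_two, Matrix.of_apply,
    Matrix.cons_val_zero, Matrix.cons_val_one, Matrix.cons_val, Pi.zero_apply, Fin.succ_zero_eq_one,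
    Fin.succ_one_eq_two]
  refine and_congr ?_ (and_congr ?_ ?_) <;> constructor <;> intro h <;> linarith

theorem SingleRelationLambda23.mulVec_eq_zero_iff (h : SingleRelationLambda23 R Ω) (hu : u ∈ Ω)
    (l : Fin 3 → ℝ) :
    algebraicMatrix R u *ᵥ ![l 1 - l 0, l 2 - l 0] = 0 ↔ l 1 = l 2 := by
  obtain ⟨-, α, h0, h1, -, hα⟩ := h u hu
  have h2 := (hα fun _ => 1).1 (by ext i; fin_cases i <;> simp [Matrix.mulVec, dotProduct])
  have h3 : α 2 = -α 1 := by simp only [h0] at h2; linarith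
  rw [hα l, h0, h3]
  constructor
  · intro h4
    have : α 1 * (l 1 - l 2) = 0 := by linarith
    rcases mul_eq_zero.1 this with h5 | h5
    · exact absurd h5 h1
    · linarith
  · intro h4
    rw [h4]; ring

/-- The vector (0,1,1) satisfies the relation, hence all three algebraic equations. The first
identity is the involutivity of span{R₂,R₃}. -/
theorem SingleRelationLambda23.christoffel_eq (h : SingleRelationLambda23 R Ω) (hu : u ∈ Ω) :
    christoffel R 0 2 1 u = christoffel R 0 1 2 u ∧ christoffel R 1 2 0 u = 0 ∧
      christoffel R 2 1 0 u = 0 := by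
  have h1 := (algebraicMatrix_mulVec_eq_zero_iff _).1
    ((h.mulVec_eq_zero_iff hu ![0, 1, 1]).2 (by simp))
  simpa using h1

theorem IsLambdaSolution.lambda_eq (hl : IsLambdaSolution R U lam)
    (h : SingleRelationLambda23 R Ω) (hU : U ⊆ Ω) (hu : u ∈ U) : lam u 1 = lam u 2 := by
  refine (h.mulVec_eq_zero_iff (hU hu) _).1 ((algebraicMatrix_mulVec_eq_zero_iff _).2 ⟨?_, ?_, ?_⟩)
  · exact hl.algebraic u hu 1 2 0 (by decide) (by decide) (by decide)
  · exact hl.algebraic u hu 0 2 1 (by decide) (by decide) (by decide)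
  · exact hl.algebraic u hu 0 1 2 (by decide) (by decide) (by decide)

theorem IsLambdaSolution.differentiableAt_apply (hl : IsLambdaSolution R U lam) (hU : IsOpen U)
    (hu : u ∈ U) (i : Fin 3) : DifferentiableAt ℝ (fun v => lam v i) u :=
  differentiableAt_pi.1 (hl.differentiableOn.differentiableAt (hU.mem_nhds hu)) i

theorem IsLambdaSolution.frameDeriv_two (hl : IsLambdaSolution R U lam)
    (h : SingleRelationLambda23 R Ω) (hUo : IsOpen U) (hU : U ⊆ Ω) (hu : u ∈ U) (i : Fin 3) :
    frameDeriv R i (fun v => lam v 1) u = frameDeriv R i (fun v => lam v 2) u := by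
  refine frameDeriv_congr ?_ i
  filter_upwards [hUo.mem_nhds hu] with v hv using hl.lambda_eq h hU hv

/-- On the common value `λ² = λ³`, the differential part of the `λ`-system. -/
theorem IsLambdaSolution.frameDeriv_lambda (hl : IsLambdaSolution R U lam)
    (h : SingleRelationLambda23 R Ω) (hUo : IsOpen U) (hU : U ⊆ Ω) (hu : u ∈ U) :
    frameDeriv R 0 (fun v => lam v 1) u = christoffel R 1 1 0 u * (lam u 0 - lam u 1) ∧
    frameDeriv R 0 (fun v => lam v 1) u = christoffel R 2 2 0 u * (lam u 0 - lam u 1) ∧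
    frameDeriv R 1 (fun v => lam v 1) u = 0 ∧ frameDeriv R 2 (fun v => lam v 1) u = 0 := by
  have h12 := hl.lambda_eq h hU hu
  refine ⟨hl.differential u hu 0 1 (by decide), ?_, ?_, ?_⟩
  · rw [hl.frameDeriv_two h hUo hU hu, h12]
    exact hl.differential u hu 0 2 (by decide)
  · rw [hl.frameDeriv_two h hUo hU hu, hl.differential u hu 1 2 (by decide), h12]
    ring
  · rw [hl.differential u hu 2 1 (by decide), h12]
    ring

theorem isLambdaSolution_of_const {n : ℕ} {R : Fin n → (Fin n → ℝ) → (Fin n → ℝ)}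
    {U : Set (Fin n → ℝ)} {lam : (Fin n → ℝ) → Fin n → ℝ} (hU : IsOpen U) {c : ℝ}
    (hc : ∀ u ∈ U, ∀ i, lam u i = c) : IsLambdaSolution R U lam where
  differentiableOn := (differentiableOn_const fun _ => c).congr fun u hu => funext (hc u hu)
  differential := by
    intro u hu i j _
    have h1 : (fun v => lam v j) =ᶠ[𝓝 u] fun _ => c := by
      filter_upwards [hU.mem_nhds hu] with v hv using hc v hv j
    simp [frameDeriv, h1.fderiv_eq, hc u hu]
  algebraic := by
    intro u hu i j k _ _ _
    simp [hc u hu]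

/-- If λ¹ ≠ λ² at a point, this persists nearby, where density gives a point at which the two
expressions for r₁λ² disagree. -/
theorem onlyTrivialSolutions_of_dense (hR : IsFrameOn R Ω)
    (h : SingleRelationLambda23 R Ω)
    (hd : Ω ⊆ closure {u ∈ Ω | christoffel R 2 2 0 u ≠ christoffel R 1 1 0 u}) :
    OnlyTrivialSolutions R Ω := by
  intro U hUo hUc hU lam
  refine ⟨fun hl => ?_, fun ⟨c, hc⟩ => isLambdaSolution_of_const hUo hc⟩
  have h01 : ∀ u ∈ U, lam u 0 = lam u 1 := by
    intro u hu
    by_contra hne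
    have hopen : ∀ᶠ v in 𝓝 u, v ∈ U ∧ lam v 0 ≠ lam v 1 := by
      refine (hUo.eventually_mem hu).and ?_
      filter_upwards [((hl.differentiableAt_apply hUo hu 0).continuousAt.sub
        (hl.differentiableAt_apply hUo hu 1).continuousAt).eventually_ne (sub_ne_zero.2 hne)]
        with v hv using sub_ne_zero.1 hv
    obtain ⟨v, ⟨hvU, hv⟩, -, hvne⟩ := mem_closure_iff_nhds.1 (hd (hU hu)) _ hopen
    obtain ⟨h1, h2, -, -⟩ := hl.frameDeriv_lambda h hUo hU hvU
    rw [h1] at h2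
    exact hvne (mul_right_cancel₀ (sub_ne_zero.2 hv) h2.symm)
  have hder : ∀ u ∈ U, fderiv ℝ (fun v => lam v 1) u = 0 := by
    intro u hu
    obtain ⟨h1, -, h3, h4⟩ := hl.frameDeriv_lambda h hUo hU hu
    refine fderiv_eq_zero_of_frameDeriv (hR u (hU hu)) fun k => ?_
    fin_cases k
    · simpa [h01 u hu] using h1
    · exact h3
    · exact h4
  obtain ⟨c, hc⟩ := hUo.exists_is_const_of_fderiv_eq_zero hUc
    (fun u hu => (hl.differentiableAt_apply hUo hu 1).differentiableWithinAt) hder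
  refine ⟨c, fun u hu i => ?_⟩
  fin_cases i
  · exact (h01 u hu).trans (hc u hu)
  · exact hc u hu
  · exact (hl.lambda_eq h hU hu).symm.trans (hc u hu)

/-- Off the closure the two functions agree on an open set, so the identity theorem would make them
equal on all of Ω. -/
theorem dense_setOf_ne_of_analytic {E : Type*} [NormedAddCommGroup E] [NormedSpace ℝ E]
    {Ω : Set E} {f g : E → ℝ} (hΩ : IsOpen Ω) (hc : IsPreconnected Ω)
    (hf : AnalyticOnNhd ℝ f Ω) (hg : AnalyticOnNhd ℝ g Ω) (hne : ∃ u ∈ Ω, f u ≠ g u) :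
    Ω ⊆ closure {u ∈ Ω | f u ≠ g u} := by
  intro u hu
  by_contra hcl
  obtain ⟨v, hv, hfg⟩ := hne
  refine hfg (hf.eqOn_of_preconnected_of_eventuallyEq hg hc hu ?_ hv)
  filter_upwards [hΩ.mem_nhds hu, isClosed_closure.isOpen_compl.mem_nhds hcl] with w hw hw'
  by_contra hne
  exact hw' (subset_closure ⟨hw, hne⟩)

end Algebra

/-! ### A family of frames realizing both situations. -/

section Examples

/-- The only nonzero row of N is then (-1, 1), which expresses λ³ - λ² = 0. -/
theorem singleRelation_of_christoffel {R : Fin 3 → (Fin 3 → ℝ) → (Fin 3 → ℝ)}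
    {Ω : Set (Fin 3 → ℝ)}
    (h : ∀ u ∈ Ω, christoffel R 0 2 1 u = 0 ∧ christoffel R 0 1 2 u = 0 ∧
      christoffel R 1 2 0 u = 0 ∧ christoffel R 1 0 2 u = 1 ∧
      christoffel R 2 0 1 u = 0 ∧ christoffel R 2 1 0 u = 0) :
    SingleRelationLambda23 R Ω := by
  intro u hu
  obtain ⟨h1, h2, h3, h4, h5, h6⟩ := h u hu
  refine ⟨?_, ![0, 1, -1], rfl, by simp, by simp, fun l => ?_⟩
  · have : algebraicMatrix R u = Matrix.vecMulVec ![0, 1, 0] ![-1, 1] := by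
      ext i j
      fin_cases i <;> fin_cases j <;>
        simp [algebraicMatrix, h1, h2, h3, h4, h5, h6, Matrix.vecMulVec]
    refine le_antisymm (this ▸ Matrix.rank_vecMulVec_le _ _) ?_
    rw [Nat.one_le_iff_ne_zero, Ne, Matrix.rank, Submodule.finrank_eq_zero,
      LinearMap.range_eq_bot, this]
    intro h0
    simpa [Matrix.vecMulVec, Matrix.mulVec, dotProduct] using
      congrFun (LinearMap.congr_fun h0 ![0, 1]) 1
  · rw [algebraicMatrix_mulVec_eq_zero_iff, h1, h2, h3, h4, h5, h6]
    simp
    constructor <;> intro h <;> linarith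

/-- The frame `R₁ = (1, κ u₁ u₃, κ u₃)`, `R₂ = (0, 1, 0)`, `R₃ = (0, u₁, 1)`. -/
def shearFrame (κ : ℝ) : Fin 3 → (Fin 3 → ℝ) → (Fin 3 → ℝ) :=
  ![fun u => ![1, κ * (u 0 * u 2), κ * u 2], fun _ => ![0, 1, 0], fun u => ![0, u 0, 1]]

theorem frameMatrix_shearFrame (κ : ℝ) (u : Fin 3 → ℝ) :
    frameMatrix (shearFrame κ) u = !![1, 0, 0; κ * (u 0 * u 2), 1, u 0; κ * u 2, 0, 1] := by
  ext i j
  fin_cases i <;> fin_cases j <;> simp [frameMatrix, shearFrame]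

theorem frameMatrix_shearFrame_mul (κ : ℝ) (u : Fin 3 → ℝ) :
    frameMatrix (shearFrame κ) u * !![1, 0, 0; 0, 1, -u 0; -(κ * u 2), 0, 1] = 1 := by
  rw [frameMatrix_shearFrame]
  ext i j
  fin_cases i <;> fin_cases j <;> simp [Matrix.mul_apply, Fin.sum_univ_three]
  ring

theorem dualCovector_shearFrame (κ : ℝ) (u : Fin 3 → ℝ) (k : Fin 3) :
    dualCovector (shearFrame κ) u k = !![1, 0, 0; 0, 1, -u 0; -(κ * u 2), 0, 1] k := by
  rw [dualCovector, Matrix.inv_eq_right_inv (frameMatrix_shearFrame_mul κ u)]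

theorem isFrameOn_shearFrame (κ : ℝ) (Ω : Set (Fin 3 → ℝ)) : IsFrameOn (shearFrame κ) Ω :=
  fun u _ => Matrix.linearIndependent_cols_iff_isUnit.2
    (IsUnit.of_mul_eq_one _ (frameMatrix_shearFrame_mul κ u))

theorem fderiv_shearFrame_zero (κ : ℝ) (u v : Fin 3 → ℝ) :
    fderiv ℝ (shearFrame κ 0) u v = ![0, κ * (u 0 * v 2 + v 0 * u 2), κ * v 2] := by
  have h : ∀ i, HasFDerivAt (fun w : Fin 3 → ℝ => w i)
    (ContinuousLinearMap.proj (R := ℝ) (φ := fun _ : Fin 3 => ℝ) i) u := fun i => hasFDerivAt_apply i u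
  have : HasFDerivAt (shearFrame κ 0) (ContinuousLinearMap.pi
    ![0, κ • (u 0 • ContinuousLinearMap.proj (R := ℝ) (φ := fun _ : Fin 3 => ℝ) 2 +
      u 2 • ContinuousLinearMap.proj (R := ℝ) (φ := fun _ : Fin 3 => ℝ) 0),
      κ • ContinuousLinearMap.proj (R := ℝ) (φ := fun _ : Fin 3 => ℝ) 2]) u := by
    refine hasFDerivAt_pi.2 fun i => ?_
    fin_cases i
    · exact hasFDerivAt_const _ _
    · exact ((h 0).mul (h 2)).const_mul κ
    · exact (h 2).const_mul κ
  rw [this.fderiv]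
  ext i
  fin_cases i <;> simp
  ring

theorem fderiv_shearFrame_one (κ : ℝ) (u v : Fin 3 → ℝ) : fderiv ℝ (shearFrame κ 1) u v = 0 := by
  simp [shearFrame]

theorem fderiv_shearFrame_two (κ : ℝ) (u v : Fin 3 → ℝ) :
    fderiv ℝ (shearFrame κ 2) u v = ![0, v 0, 0] := by
  have : HasFDerivAt (shearFrame κ 2) (ContinuousLinearMap.pi
    ![0, ContinuousLinearMap.proj (R := ℝ) (φ := fun _ : Fin 3 => ℝ) 0, 0]) u := by
    refine hasFDerivAt_pi.2 fun i => ?_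
    fin_cases i
    · exact hasFDerivAt_const _ _
    · exact hasFDerivAt_apply 0 u
    · exact hasFDerivAt_const _ _
  rw [this.fderiv]
  ext i
  fin_cases i <;> simp

theorem analyticOnNhd_shearFrame (κ : ℝ) (i : Fin 3) (Ω : Set (Fin 3 → ℝ)) :
    AnalyticOnNhd ℝ (shearFrame κ i) Ω := by
  intro u _
  have h : ∀ i, AnalyticAt ℝ (fun w : Fin 3 → ℝ => w i) u := fun i =>
    (ContinuousLinearMap.proj (R := ℝ) (φ := fun _ : Fin 3 => ℝ) i).analyticAt u
  refine analyticAt_pi_iff.2 fun j => ?_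
  fin_cases i <;> fin_cases j
  · exact analyticAt_const
  · exact analyticAt_const.mul ((h 0).mul (h 2))
  · exact analyticAt_const.mul (h 2)
  · exact analyticAt_const
  · exact analyticAt_const
  · exact analyticAt_const
  · exact analyticAt_const
  · exact h 0
  · exact analyticAt_const

theorem singleRelation_shearFrame (κ : ℝ) (Ω : Set (Fin 3 → ℝ)) :
    SingleRelationLambda23 (shearFrame κ) Ω := by
  refine singleRelation_of_christoffel fun u _ => ?_
  simp only [christoffel, dualCovector_shearFrame, fderiv_shearFrame_zero, fderiv_shearFrame_one,
    fderiv_shearFrame_two]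
  simp [shearFrame, dotProduct, Fin.sum_univ_three]
  ring

/-- Since R₁ = e₁ + κ u₃ R₃ and R₃ does not vary along itself, DR₁(R₃) = κ R₃, while DR₁(R₂) = 0. -/
theorem christoffel_shearFrame (κ : ℝ) (u : Fin 3 → ℝ) :
    christoffel (shearFrame κ) 2 2 0 u = κ ∧ christoffel (shearFrame κ) 1 1 0 u = 0 := by
  simp only [christoffel, dualCovector_shearFrame, fderiv_shearFrame_zero]
  simp [shearFrame, dotProduct, Fin.sum_univ_three]

end Examples

/-! ### Uniqueness for scalar linear ODEs. -/

section LinearODE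

/-- Grönwall's inequality for positive times, then the reflection s ↦ -s for negative ones. -/
theorem eq_zero_on_ball_of_abs_deriv_le {f f' : ℝ → ℝ} {K ε : ℝ}
    (hf : ∀ s ∈ Metric.ball (0 : ℝ) ε, HasDerivAt f (f' s) s)
    (hK : ∀ s ∈ Metric.ball (0 : ℝ) ε, |f' s| ≤ K * |f s|) (h0 : f 0 = 0) :
    ∀ s ∈ Metric.ball (0 : ℝ) ε, f s = 0 := by
  have pos : ∀ {f f' : ℝ → ℝ}, (∀ s ∈ Metric.ball (0 : ℝ) ε, HasDerivAt f (f' s) s) →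
      (∀ s ∈ Metric.ball (0 : ℝ) ε, |f' s| ≤ K * |f s|) → f 0 = 0 →
      ∀ s ∈ Metric.ball (0 : ℝ) ε, 0 ≤ s → f s = 0 := by
    intro f f' hf hK h0 s hs hs0
    have hsub : Set.Icc 0 s ⊆ Metric.ball (0 : ℝ) ε := by
      rw [Real.ball_eq_Ioo] at hs ⊢
      intro r hr
      exact ⟨by linarith [hr.1, hr.2, hs.2], hr.2.trans_lt hs.2⟩
    exact eq_zero_of_abs_deriv_le_mul_abs_self_of_eq_zero_right (K := K) (a := 0) (b := s)
      (fun r hr => (hf r (hsub hr)).continuousAt.continuousWithinAt)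
      (fun r hr => (hf r (hsub (Set.Ico_subset_Icc_self hr))).hasDerivWithinAt) h0
      (fun r hr => hK r (hsub (Set.Ico_subset_Icc_self hr))) s ⟨hs0, le_rfl⟩
  intro s hs
  rcases le_total 0 s with h | h
  · exact pos hf hK h0 s hs h
  · have hneg : ∀ r ∈ Metric.ball (0 : ℝ) ε, -r ∈ Metric.ball (0 : ℝ) ε := by
      intro r hr
      simpa using hr
    have := pos (f := fun r => f (-r)) (f' := fun r => -f' (-r))
      (fun r hr => by simpa [Function.comp_def] using (hf (-r) (hneg r hr)).comp r (hasDerivAt_neg r))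
      (fun r hr => by simpa using hK (-r) (hneg r hr)) (by simpa using h0) (-s) (hneg s hs)
      (by linarith)
    simpa using this

/-- Local uniqueness for a scalar linear differential equation with parameters. -/
theorem eventually_eq_zero_of_linear_ode {X : Type*} [TopologicalSpace X] {x₀ : X}
    {H H' B : X × ℝ → ℝ} (hB : ContinuousAt B (x₀, 0))
    (hH : ∀ᶠ q in 𝓝 (x₀, (0 : ℝ)), HasDerivAt (fun s => H (q.1, s)) (H' q) q.2)
    (hH' : ∀ᶠ q in 𝓝 (x₀, (0 : ℝ)), H' q = B q * H q)
    (h0 : ∀ᶠ x in 𝓝 x₀, H (x, 0) = 0) : ∀ᶠ q in 𝓝 (x₀, (0 : ℝ)), H q = 0 := by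
  have hbd : ∀ᶠ q in 𝓝 (x₀, (0 : ℝ)), |B q| < |B (x₀, 0)| + 1 :=
    hB.abs.eventually_lt_const (lt_add_one _)
  have hall := hbd.and (hH.and hH')
  rw [nhds_prod_eq] at hall ⊢
  obtain ⟨P, hP, Q, hQ, hPQ⟩ := eventually_prod_iff.1 hall
  -- A ball of times is an interval around 0, so the vanishing at time 0 propagates to all of it.
  obtain ⟨ε, hε, hball⟩ := Metric.eventually_nhds_iff_ball.1 hQ
  refine eventually_prod_iff.2
    ⟨fun x => P x ∧ H (x, 0) = 0, hP.and h0, fun s => s ∈ Metric.ball (0 : ℝ) ε,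
      Metric.ball_mem_nhds _ hε, fun {x} hx {s} hs => ?_⟩
  refine eq_zero_on_ball_of_abs_deriv_le (f := fun r => H (x, r)) (f' := fun r => H' (x, r))
    (K := |B (x₀, 0)| + 1) (ε := ε) (fun r hr => (hPQ hx.1 (hball r hr)).2.1)
    (fun r hr => ?_) hx.2 s hs
  have h1 := hPQ hx.1 (hball r hr)
  rw [h1.2.2, abs_mul]
  exact mul_le_mul_of_nonneg_right h1.1.le (abs_nonneg _)

end LinearODE

/-! ### Coordinates built from γ and the flows of R₂ and R₃. -/

section AdaptedChart

/-- `Ψ ((t, s), r)` is obtained from `γ t` by following `R₂` for time `s`, then `R₃` for time `r`;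
`Θ` is the local inverse of `Ψ`. -/
structure IsAdaptedChart (R : Fin 3 → (Fin 3 → ℝ) → (Fin 3 → ℝ)) (p : Fin 3 → ℝ)
    (γ : ℝ → Fin 3 → ℝ) (Ψ : (ℝ × ℝ) × ℝ → Fin 3 → ℝ) (Θ : (Fin 3 → ℝ) → (ℝ × ℝ) × ℝ) :
    Prop where
  analyticAt : AnalyticAt ℝ Ψ 0
  analyticAt_inv : AnalyticAt ℝ Θ p
  apply_zero : Ψ 0 = p
  inv_apply : ∀ᶠ q in 𝓝 0, Θ (Ψ q) = q
  apply_inv : ∀ᶠ u in 𝓝 p, Ψ (Θ u) = u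
  curve : ∀ᶠ t in 𝓝 0, Ψ ((t, 0), 0) = γ t
  deriv_one : ∀ᶠ x in 𝓝 (0 : ℝ × ℝ),
    HasDerivAt (fun s => Ψ ((x.1, s), 0)) (R 1 (Ψ (x, 0))) x.2
  deriv_two : ∀ᶠ q in 𝓝 (0 : (ℝ × ℝ) × ℝ), HasDerivAt (fun r => Ψ (q.1, r)) (R 2 (Ψ q)) q.2

variable {R : Fin 3 → (Fin 3 → ℝ) → (Fin 3 → ℝ)} {p : Fin 3 → ℝ} {γ : ℝ → Fin 3 → ℝ}
  {Ψ : (ℝ × ℝ) × ℝ → Fin 3 → ℝ} {Θ : (Fin 3 → ℝ) → (ℝ × ℝ) × ℝ}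

namespace IsAdaptedChart

theorem tendsto (h : IsAdaptedChart R p γ Ψ Θ) : Tendsto Ψ (𝓝 0) (𝓝 p) := by
  simpa [h.apply_zero] using h.analyticAt.continuousAt.tendsto

theorem inv_base (h : IsAdaptedChart R p γ Ψ Θ) : Θ p = 0 := by
  simpa [h.apply_zero] using h.inv_apply.self_of_nhds

theorem tendsto_inv (h : IsAdaptedChart R p γ Ψ Θ) : Tendsto Θ (𝓝 p) (𝓝 0) := by
  simpa [h.inv_base] using h.analyticAt_inv.continuousAt.tendsto

theorem eventually_of_comp (h : IsAdaptedChart R p γ Ψ Θ) {P : (Fin 3 → ℝ) → Prop}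
    (hP : ∀ᶠ q in 𝓝 0, P (Ψ q)) : ∀ᶠ u in 𝓝 p, P u := by
  filter_upwards [h.tendsto_inv.eventually hP, h.apply_inv] with u h1 h2
  rwa [h2] at h1

theorem tendsto_surface (h : IsAdaptedChart R p γ Ψ Θ) :
    Tendsto (fun x : ℝ × ℝ => Ψ (x, 0)) (𝓝 0) (𝓝 p) :=
  h.tendsto.comp ((Continuous.prodMk_left (X := ℝ × ℝ) (Y := ℝ) 0).tendsto' 0 0 rfl)

theorem hasDerivAt_comp_one (h : IsAdaptedChart R p γ Ψ Θ) {f : (Fin 3 → ℝ) → ℝ}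
    (hf : ∀ᶠ u in 𝓝 p, DifferentiableAt ℝ f u) :
    ∀ᶠ x in 𝓝 (0 : ℝ × ℝ),
      HasDerivAt (fun s => f (Ψ ((x.1, s), 0))) (frameDeriv R 1 f (Ψ (x, 0))) x.2 := by
  filter_upwards [h.deriv_one, h.tendsto_surface.eventually hf] with x hx hfx
  exact hfx.hasFDerivAt.comp_hasDerivAt (f := fun s => Ψ ((x.1, s), 0)) x.2 hx

theorem hasDerivAt_comp_two (h : IsAdaptedChart R p γ Ψ Θ) {f : (Fin 3 → ℝ) → ℝ}
    (hf : ∀ᶠ u in 𝓝 p, DifferentiableAt ℝ f u) :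
    ∀ᶠ q in 𝓝 (0 : (ℝ × ℝ) × ℝ),
      HasDerivAt (fun r => f (Ψ (q.1, r))) (frameDeriv R 2 f (Ψ q)) q.2 := by
  filter_upwards [h.deriv_two, h.tendsto.eventually hf] with q hq hfq
  exact hfq.hasFDerivAt.comp_hasDerivAt (f := fun r => Ψ (q.1, r)) q.2 hq

/-- The equation along R₂ is only needed on r = 0, because in the chart the curves in s follow R₂
there but not necessarily elsewhere. -/
theorem eq_zero_on_surface (h : IsAdaptedChart R p γ Ψ Θ) {f A : (Fin 3 → ℝ) → ℝ}
    (hf : ∀ᶠ u in 𝓝 p, DifferentiableAt ℝ f u) (hA : ContinuousAt A p)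
    (hfA : ∀ᶠ x in 𝓝 (0 : ℝ × ℝ),
      frameDeriv R 1 f (Ψ (x, 0)) = A (Ψ (x, 0)) * f (Ψ (x, 0)))
    (h0 : ∀ᶠ t in 𝓝 0, f (γ t) = 0) : ∀ᶠ x in 𝓝 (0 : ℝ × ℝ), f (Ψ (x, 0)) = 0 := by
  refine eventually_eq_zero_of_linear_ode (x₀ := (0 : ℝ)) (H := fun x => f (Ψ (x, 0)))
    (H' := fun x => frameDeriv R 1 f (Ψ (x, 0))) (B := fun x => A (Ψ (x, 0))) ?_
    (h.hasDerivAt_comp_one hf) hfA ?_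
  · have h1 : Ψ (((0 : ℝ), (0 : ℝ)), (0 : ℝ)) = p := h.apply_zero
    have := hA.tendsto.comp h.tendsto_surface
    rw [← h1] at this
    exact this
  · filter_upwards [h0, h.curve] with t ht ht'
    rw [ht', ht]

theorem eq_zero_of_surface (h : IsAdaptedChart R p γ Ψ Θ) {f B : (Fin 3 → ℝ) → ℝ}
    (hf : ∀ᶠ u in 𝓝 p, DifferentiableAt ℝ f u) (hB : ContinuousAt B p)
    (hfB : ∀ᶠ u in 𝓝 p, frameDeriv R 2 f u = B u * f u)
    (h0 : ∀ᶠ x in 𝓝 (0 : ℝ × ℝ), f (Ψ (x, 0)) = 0) : ∀ᶠ u in 𝓝 p, f u = 0 := by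
  refine h.eventually_of_comp ?_
  refine eventually_eq_zero_of_linear_ode (x₀ := (0 : ℝ × ℝ)) (H := fun q => f (Ψ q))
    (H' := fun q => frameDeriv R 2 f (Ψ q)) (B := fun q => B (Ψ q)) ?_
    (h.hasDerivAt_comp_two hf) (h.tendsto.eventually hfB) h0
  have h1 : Ψ ((0 : ℝ × ℝ), (0 : ℝ)) = p := h.apply_zero
  have := hB.tendsto.comp h.tendsto
  rw [← h1] at this
  exact this

/-- A function that vanishes on the curve and solves linear equations along `R₂` and `R₃`
vanishes. -/
theorem eq_zero_of_curve (h : IsAdaptedChart R p γ Ψ Θ) {f A B : (Fin 3 → ℝ) → ℝ}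
    (hf : ∀ᶠ u in 𝓝 p, DifferentiableAt ℝ f u) (hA : ContinuousAt A p) (hB : ContinuousAt B p)
    (hfA : ∀ᶠ u in 𝓝 p, frameDeriv R 1 f u = A u * f u)
    (hfB : ∀ᶠ u in 𝓝 p, frameDeriv R 2 f u = B u * f u)
    (h0 : ∀ᶠ t in 𝓝 0, f (γ t) = 0) : ∀ᶠ u in 𝓝 p, f u = 0 :=
  h.eq_zero_of_surface hf hB hfB
    (h.eq_zero_on_surface hf hA (h.tendsto_surface.eventually hfA) h0)

end IsAdaptedChart

/-- Adapted charts exist, together with a function solving linear equations along `R₂` (on the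
surface `r = 0`) and along `R₃`, with prescribed values on the curve. -/
theorem exists_isAdaptedChart (hR : ∀ i, AnalyticAt ℝ (R i) p)
    (hL : LinearIndependent ℝ fun j => R j p) (hγ : AnalyticAt ℝ γ 0) (hγ0 : γ 0 = p)
    (htr : dualCovector R p 0 ⬝ᵥ deriv γ 0 ≠ 0) {a b : (Fin 3 → ℝ) → ℝ}
    (ha : AnalyticAt ℝ a p) (hb : AnalyticAt ℝ b p) {e₀ : ℝ → ℝ} (he : AnalyticAt ℝ e₀ 0) :
    ∃ Ψ Θ, IsAdaptedChart R p γ Ψ Θ ∧ ∃ W : (ℝ × ℝ) × ℝ → ℝ, AnalyticAt ℝ W 0 ∧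
      (∀ᶠ t in 𝓝 0, W ((t, 0), 0) = e₀ t) ∧
      (∀ᶠ x in 𝓝 (0 : ℝ × ℝ), HasDerivAt (fun s => W ((x.1, s), 0))
        (a (Ψ (x, 0)) * W (x, 0)) x.2) ∧
      (∀ᶠ q in 𝓝 (0 : (ℝ × ℝ) × ℝ), HasDerivAt (fun r => W (q.1, r))
        (b (Ψ q) * W q) q.2) := by
  -- Adjoining a scalar coordinate z with z' = k z lets a single flow carry both the chart and the
  -- linear transport.
  have flow : ∀ (X : (Fin 3 → ℝ) → (Fin 3 → ℝ)) (k : (Fin 3 → ℝ) → ℝ), AnalyticAt ℝ X p →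
      AnalyticAt ℝ k p → AnalyticAt ℝ
        (fun z : (Fin 3 → ℝ) × ℝ => (X z.1, k z.1 * z.2)) (p, e₀ 0) := by
    intro X k hX hk
    have h1 : AnalyticAt ℝ (fun z : (Fin 3 → ℝ) × ℝ => X z.1) (p, e₀ 0) :=
      AnalyticAt.comp (g := X) (f := Prod.fst) hX analyticAt_fst
    have h2 : AnalyticAt ℝ (fun z : (Fin 3 → ℝ) × ℝ => k z.1) (p, e₀ 0) :=
      AnalyticAt.comp (g := k) (f := Prod.fst) hk analyticAt_fst
    exact h1.prod (h2.mul analyticAt_snd)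
  obtain ⟨Φ₁, hΦ₁, hΦ₁0, hΦ₁d⟩ := (flow _ _ (hR 1) ha).exists_analyticAt_flow
  obtain ⟨Φ₂, hΦ₂, hΦ₂0, hΦ₂d⟩ := (flow _ _ (hR 2) hb).exists_analyticAt_flow
  let C : ℝ × ℝ → ℝ × ((Fin 3 → ℝ) × ℝ) := fun x => (x.2, (γ x.1, e₀ x.1))
  have hC : AnalyticAt ℝ C 0 := by
    refine analyticAt_snd.prod (AnalyticAt.prod ?_ ?_)
    · exact AnalyticAt.comp (g := γ) (f := Prod.fst) hγ analyticAt_fst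
    · exact AnalyticAt.comp (g := e₀) (f := Prod.fst) he analyticAt_fst
  have hC0 : C 0 = (0, (p, e₀ 0)) := by simp [C, hγ0]
  let S : ℝ × ℝ → (Fin 3 → ℝ) × ℝ := fun x => Φ₁ (C x)
  have hS : AnalyticAt ℝ S 0 := AnalyticAt.comp (by rwa [hC0]) hC
  have hS0 : S 0 = (p, e₀ 0) := by
    simp only [S, hC0]
    exact hΦ₁0.self_of_nhds
  let D : (ℝ × ℝ) × ℝ → ℝ × ((Fin 3 → ℝ) × ℝ) := fun q => (q.2, S q.1)
  have hD : AnalyticAt ℝ D 0 :=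
    analyticAt_snd.prod (AnalyticAt.comp (g := S) (f := Prod.fst) hS analyticAt_fst)
  have hD0 : D 0 = (0, (p, e₀ 0)) := by simp [D, hS0]
  let G : (ℝ × ℝ) × ℝ → (Fin 3 → ℝ) × ℝ := fun q => Φ₂ (D q)
  have hG : AnalyticAt ℝ G 0 := AnalyticAt.comp (by rwa [hD0]) hD
  have hG0 : G 0 = (p, e₀ 0) := by
    simp only [G, hD0]
    exact hΦ₂0.self_of_nhds
  have hCt : Tendsto C (𝓝 0) (𝓝 (0, (p, e₀ 0))) := hC0 ▸ hC.continuousAt.tendsto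
  have hDt : Tendsto D (𝓝 0) (𝓝 (0, (p, e₀ 0))) := hD0 ▸ hD.continuousAt.tendsto
  have hSt : Tendsto S (𝓝 0) (𝓝 (p, e₀ 0)) := hS0 ▸ hS.continuousAt.tendsto
  have hGS : ∀ᶠ x in 𝓝 (0 : ℝ × ℝ), G (x, 0) = S x := by
    filter_upwards [hSt.eventually hΦ₂0] with x hx using hx
  have hGγ : ∀ᶠ t in 𝓝 (0 : ℝ), G ((t, 0), 0) = (γ t, e₀ t) := by
    have h1 : Tendsto (fun t : ℝ => (t, (0 : ℝ))) (𝓝 0) (𝓝 0) :=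
      (Continuous.prodMk_left (X := ℝ) (Y := ℝ) 0).tendsto' 0 0 rfl
    have h2 : Tendsto (fun t : ℝ => (γ t, e₀ t)) (𝓝 0) (𝓝 (p, e₀ 0)) :=
      hγ0 ▸ (hγ.continuousAt.prodMk he.continuousAt).tendsto
    filter_upwards [h1.eventually hGS, h2.eventually hΦ₁0] with t ht ht'
    rw [ht]
    exact ht'
  have hG1 : ∀ᶠ x in 𝓝 (0 : ℝ × ℝ), HasDerivAt (fun s => G ((x.1, s), 0))
      (R 1 (G (x, 0)).1, a (G (x, 0)).1 * (G (x, 0)).2) x.2 := by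
    filter_upwards [hCt.eventually hΦ₁d, hGS.eventually_nhds] with x hx hx'
    rw [hx'.self_of_nhds]
    refine HasDerivAt.congr_of_eventuallyEq hx ?_
    exact ((Continuous.prodMk_right x.1).tendsto' x.2 x rfl).eventually hx'
  have hG2 : ∀ᶠ q in 𝓝 (0 : (ℝ × ℝ) × ℝ), HasDerivAt (fun r => G (q.1, r))
      (R 2 (G q).1, b (G q).1 * (G q).2) q.2 := by
    filter_upwards [hDt.eventually hΦ₂d] with q hq using hq
  let Ψ : (ℝ × ℝ) × ℝ → Fin 3 → ℝ := fun q => (G q).1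
  have hΨ : AnalyticAt ℝ Ψ 0 := analyticAt_fst.comp hG
  have hΨ0 : Ψ 0 = p := by simp [Ψ, hG0]
  have hcurve : ∀ᶠ t in 𝓝 (0 : ℝ), Ψ ((t, 0), 0) = γ t := by
    filter_upwards [hGγ] with t ht
    simp [Ψ, ht]
  have hd1 : ∀ᶠ x in 𝓝 (0 : ℝ × ℝ),
      HasDerivAt (fun s => Ψ ((x.1, s), 0)) (R 1 (Ψ (x, 0))) x.2 := by
    filter_upwards [hG1] with x hx using hx.fst
  have hd2 : ∀ᶠ q in 𝓝 (0 : (ℝ × ℝ) × ℝ), HasDerivAt (fun r => Ψ (q.1, r)) (R 2 (Ψ q)) q.2 := by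
    filter_upwards [hG2] with q hq using hq.fst
  have hF := hΨ.differentiableAt.hasFDerivAt
  set T := fderiv ℝ Ψ 0
  have hT0 : T ((1, 0), 0) = deriv γ 0 := by
    have h1 : HasDerivAt (fun t : ℝ => ((t, (0 : ℝ)), (0 : ℝ))) ((1, 0), 0) 0 :=
      ((hasDerivAt_id _).prodMk (hasDerivAt_const _ _)).prodMk (hasDerivAt_const _ _)
    have h2 := HasFDerivAt.comp_hasDerivAt (0 : ℝ) (f := fun t : ℝ => ((t, (0 : ℝ)), (0 : ℝ))) hF h1
    have h3 : HasDerivAt (fun t : ℝ => Ψ ((t, 0), 0)) (deriv γ 0) 0 :=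
      hγ.differentiableAt.hasDerivAt.congr_of_eventuallyEq hcurve
    exact h2.unique h3
  have hT1 : T ((0, 1), 0) = R 1 p := by
    have h1 : HasDerivAt (fun t : ℝ => (((0 : ℝ), t), (0 : ℝ))) ((0, 1), 0) 0 :=
      ((hasDerivAt_const _ _).prodMk (hasDerivAt_id _)).prodMk (hasDerivAt_const _ _)
    have h2 := HasFDerivAt.comp_hasDerivAt (0 : ℝ) (f := fun t : ℝ => (((0 : ℝ), t), (0 : ℝ))) hF h1
    have h3 := hd1.self_of_nhds
    have h4 : Ψ ((0 : ℝ × ℝ), (0 : ℝ)) = p := hΨ0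
    rw [h4] at h3
    exact h2.unique h3
  have hT2 : T ((0, 0), 1) = R 2 p := by
    have h1 : HasDerivAt (fun t : ℝ => (((0 : ℝ), (0 : ℝ)), t)) ((0, 0), 1) 0 :=
      (hasDerivAt_const _ _).prodMk (hasDerivAt_id _)
    have h2 := HasFDerivAt.comp_hasDerivAt (0 : ℝ) (f := fun t : ℝ => (((0 : ℝ), (0 : ℝ)), t)) hF h1
    have h3 := hd2.self_of_nhds
    rw [hΨ0] at h3
    exact h2.unique h3
  -- The derivative sends the basis to γ'(0), R₂, R₃. Applying L¹ isolates the coefficient of γ'(0),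
  -- which transversality kills; L² and L³ then give the others.
  have hinj : Function.Injective (T : (ℝ × ℝ) × ℝ →ₗ[ℝ] (Fin 3 → ℝ)) := by
    rw [← LinearMap.ker_eq_bot, LinearMap.ker_eq_bot']
    rintro ⟨⟨x, y⟩, z⟩ hq
    have h1 : ((x, y), z) =
        x • (((1 : ℝ), (0 : ℝ)), (0 : ℝ)) + y • (((0 : ℝ), (1 : ℝ)), (0 : ℝ)) +
          z • (((0 : ℝ), (0 : ℝ)), (1 : ℝ)) := by simp
    have h2 : x • deriv γ 0 + y • R 1 p + z • R 2 p = 0 := by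
      rw [ContinuousLinearMap.coe_coe, h1] at hq
      simpa only [map_add, map_smul, hT0, hT1, hT2] using hq
    have h3 : ∀ k, x * (dualCovector R p k ⬝ᵥ deriv γ 0) + y * (if k = 1 then 1 else 0) +
        z * (if k = 2 then 1 else 0) = 0 := by
      intro k
      have := congrArg (fun v => dualCovector R p k ⬝ᵥ v) h2
      simpa only [dotProduct_add, dotProduct_smul, dualCovector_dotProduct_frame hL,
        dotProduct_zero, smul_eq_mul] using this
    have hx : x = 0 := by
      have := h3 0
      simpa [htr] using this
    have hy : y = 0 := by simpa [hx] using h3 1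
    have hz : z = 0 := by simpa [hx] using h3 2
    simp [hx, hy, hz]
  let Teq := (LinearEquiv.ofInjectiveOfFinrankEq (T : (ℝ × ℝ) × ℝ →ₗ[ℝ] (Fin 3 → ℝ)) hinj
    (by simp)).toContinuousLinearEquiv
  have hTeq : (Teq : (ℝ × ℝ) × ℝ →L[ℝ] (Fin 3 → ℝ)) = T := by
    exact ContinuousLinearMap.ext fun q => rfl
  -- With the analytic exponent `⊤`, the inverse function theorem returns an analytic local inverse.
  have hcd : ContDiffAt ℝ ⊤ Ψ 0 := hΨ.contDiffAt
  have hF' : HasFDerivAt Ψ (Teq : (ℝ × ℝ) × ℝ →L[ℝ] (Fin 3 → ℝ)) 0 := by rwa [hTeq]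
  have hst : HasStrictFDerivAt Ψ (Teq : (ℝ × ℝ) × ℝ →L[ℝ] (Fin 3 → ℝ)) 0 :=
    hcd.hasStrictFDerivAt' hF' (by simp)
  refine ⟨Ψ, hst.localInverse, ⟨hΨ, ?_, hΨ0, hst.eventually_left_inverse, ?_, hcurve, hd1, hd2⟩,
    fun q => (G q).2, analyticAt_snd.comp hG, ?_, ?_, ?_⟩
  · have := (hcd.to_localInverse hF' (by simp)).analyticAt
    rwa [hΨ0] at this
  · have := hst.eventually_right_inverse
    rwa [hΨ0] at this
  · filter_upwards [hGγ] with t ht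
    simp [ht]
  · filter_upwards [hG1] with x hx using hx.snd
  · filter_upwards [hG2] with q hq using hq.snd

end AdaptedChart

/-! ### Derivatives along γ and in the adapted chart. -/

section CurveCalculus

variable {R : Fin 3 → (Fin 3 → ℝ) → (Fin 3 → ℝ)} {p : Fin 3 → ℝ} {γ : ℝ → Fin 3 → ℝ}
  {Ψ : (ℝ × ℝ) × ℝ → Fin 3 → ℝ} {Θ : (Fin 3 → ℝ) → (ℝ × ℝ) × ℝ}

theorem eventually_eq_zero_of_linear_ode_real {H H' B : ℝ → ℝ} (hB : ContinuousAt B 0)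
    (hH : ∀ᶠ t in 𝓝 0, HasDerivAt H (H' t) t) (hH' : ∀ᶠ t in 𝓝 0, H' t = B t * H t)
    (h0 : H 0 = 0) : ∀ᶠ t in 𝓝 0, H t = 0 := by
  have hsnd : Tendsto (Prod.snd : Unit × ℝ → ℝ) (𝓝 ((), 0)) (𝓝 0) := continuous_snd.tendsto' _ _ rfl
  have h := eventually_eq_zero_of_linear_ode (x₀ := ()) (H := fun q => H q.2)
    (H' := fun q => H' q.2) (B := fun q => B q.2)
    (ContinuousAt.comp (g := B) (f := Prod.snd) hB continuousAt_snd)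
    (hsnd.eventually hH) (hsnd.eventually hH') (Eventually.of_forall fun _ => h0)
  exact ((Continuous.prodMk_right (X := Unit) (Y := ℝ) ()).tendsto' 0 ((), 0) rfl).eventually h

theorem frameDeriv_comp {w : (Fin 3 → ℝ) → ℝ} {m : ℝ → ℝ} {u : Fin 3 → ℝ}
    (hm : DifferentiableAt ℝ m (w u)) (hw : DifferentiableAt ℝ w u) (k : Fin 3) :
    frameDeriv R k (fun v => m (w v)) u = deriv m (w u) * frameDeriv R k w u := by
  have := (hm.hasDerivAt.comp_hasFDerivAt u hw.hasFDerivAt).fderiv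
  simp only [Function.comp_def] at this
  simp [frameDeriv, this]

theorem hasDerivAt_comp_curve (hR : ∀ i, AnalyticAt ℝ (R i) p)
    (hL : LinearIndependent ℝ fun j => R j p) (hγ : AnalyticAt ℝ γ 0) (hγ0 : γ 0 = p)
    {f : (Fin 3 → ℝ) → ℝ} (hf : ∀ᶠ u in 𝓝 p, DifferentiableAt ℝ f u) :
    ∀ᶠ t in 𝓝 0, HasDerivAt (fun t => f (γ t))
      (∑ k, (dualCovector R (γ t) k ⬝ᵥ deriv γ t) * frameDeriv R k f (γ t)) t := by
  have hγt : Tendsto γ (𝓝 0) (𝓝 p) := hγ0 ▸ hγ.continuousAt.tendsto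
  filter_upwards [hγt.eventually hf, hγt.eventually (eventually_linearIndependent hR hL),
    hγ.eventually_analyticAt] with t h1 h2 h3
  rw [← fderiv_eq_sum_frameDeriv h2]
  exact h1.hasFDerivAt.comp_hasDerivAt t h3.differentiableAt.hasDerivAt

theorem analyticAt_curve_speed (hR : ∀ i, AnalyticAt ℝ (R i) p)
    (hL : LinearIndependent ℝ fun j => R j p) (hγ : AnalyticAt ℝ γ 0) (hγ0 : γ 0 = p)
    (k : Fin 3) : AnalyticAt ℝ (fun t => dualCovector R (γ t) k ⬝ᵥ deriv γ t) 0 := by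
  subst hγ0
  exact AnalyticAt.dotProduct
    (AnalyticAt.comp (g := fun v => dualCovector R v k) (f := γ) (analyticAt_dualCovector hR hL k) hγ)
    hγ.deriv

namespace IsAdaptedChart

/-- On r = 0 the derivative along R₂ is ∂/∂s in the chart, so it can be read off the coordinate
expression. -/
theorem frameDeriv_one_eq (h : IsAdaptedChart R p γ Ψ Θ) {f : (Fin 3 → ℝ) → ℝ}
    (hf : ∀ᶠ u in 𝓝 p, DifferentiableAt ℝ f u) {H : (ℝ × ℝ) × ℝ → ℝ} {H' : ℝ × ℝ → ℝ}
    (hfH : ∀ᶠ q in 𝓝 0, f (Ψ q) = H q)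
    (hH : ∀ᶠ x in 𝓝 (0 : ℝ × ℝ), HasDerivAt (fun s => H ((x.1, s), 0)) (H' x) x.2) :
    ∀ᶠ x in 𝓝 (0 : ℝ × ℝ), frameDeriv R 1 f (Ψ (x, 0)) = H' x := by
  have ht : Tendsto (fun x : ℝ × ℝ => (x, (0 : ℝ))) (𝓝 0) (𝓝 0) :=
    (Continuous.prodMk_left (X := ℝ × ℝ) (Y := ℝ) 0).tendsto' 0 0 rfl
  filter_upwards [h.hasDerivAt_comp_one hf, hH, ht.eventually hfH.eventually_nhds] with x h1 h2 h3
  refine h1.unique (h2.congr_of_eventuallyEq ?_)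
  have hc : Continuous fun s : ℝ => ((x.1, s), (0 : ℝ)) := by fun_prop
  exact (hc.tendsto' x.2 (x, 0) rfl).eventually h3

theorem frameDeriv_two_eq (h : IsAdaptedChart R p γ Ψ Θ) {f : (Fin 3 → ℝ) → ℝ}
    (hf : ∀ᶠ u in 𝓝 p, DifferentiableAt ℝ f u) {H H' : (ℝ × ℝ) × ℝ → ℝ}
    (hfH : ∀ᶠ q in 𝓝 0, f (Ψ q) = H q)
    (hH : ∀ᶠ q in 𝓝 (0 : (ℝ × ℝ) × ℝ), HasDerivAt (fun r => H (q.1, r)) (H' q) q.2) :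
    ∀ᶠ q in 𝓝 (0 : (ℝ × ℝ) × ℝ), frameDeriv R 2 f (Ψ q) = H' q := by
  filter_upwards [h.hasDerivAt_comp_two hf, hH, hfH.eventually_nhds] with q h1 h2 h3
  refine h1.unique (h2.congr_of_eventuallyEq ?_)
  exact ((Continuous.prodMk_right q.1).tendsto' q.2 q rfl).eventually h3

end IsAdaptedChart

end CurveCalculus

/-! ### Compatibility conditions when Γ³₃₁ = Γ²₂₁. -/

section CommonCoefficient

variable {R : Fin 3 → (Fin 3 → ℝ) → (Fin 3 → ℝ)} {Ω : Set (Fin 3 → ℝ)} {u p : Fin 3 → ℝ}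

/-- By Γ¹₃₂ = Γ¹₂₃ the bracket of R₂ and R₃ has no R₁ component. -/
theorem SingleRelationLambda23.commutator (h : SingleRelationLambda23 R Ω) (hu : u ∈ Ω)
    (hR : ∀ i, AnalyticOnNhd ℝ (R i) Ω) (hF : IsFrameOn R Ω) {f : (Fin 3 → ℝ) → ℝ}
    (hf : AnalyticAt ℝ f u) :
    frameDeriv R 2 (frameDeriv R 1 f) u - frameDeriv R 1 (frameDeriv R 2 f) u =
      (christoffel R 1 2 1 u - christoffel R 1 1 2 u) * frameDeriv R 1 f u +
      (christoffel R 2 2 1 u - christoffel R 2 1 2 u) * frameDeriv R 2 f u := by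
  rw [frameDeriv_frameDeriv_sub (fun i => hR i u hu) (hF u hu) hf, Fin.sum_univ_three,
    (h.christoffel_eq hu).1]
  ring


/-- This is the integrability condition for r₂e = -Γ¹₁₂ e, r₃e = -Γ¹₁₃ e. In the difference of two
curvature identities the derivatives of Γ¹₂₃ and Γ¹₃₂ along R₁ cancel. -/
theorem SingleRelationLambda23.closed (h : SingleRelationLambda23 R Ω) (hΩ : IsOpen Ω)
    (hR : ∀ i, AnalyticOnNhd ℝ (R i) Ω) (hF : IsFrameOn R Ω) (hu : u ∈ Ω)
    (hg : ∀ u ∈ Ω, christoffel R 2 2 0 u = christoffel R 1 1 0 u) :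
    frameDeriv R 1 (christoffel R 0 0 2) u - frameDeriv R 2 (christoffel R 0 0 1) u =
      (christoffel R 1 1 2 u - christoffel R 1 2 1 u) * christoffel R 0 0 1 u +
      (christoffel R 2 1 2 u - christoffel R 2 2 1 u) * christoffel R 0 0 2 u := by
  have h1 := frameDeriv_christoffel_sub (fun i => hR i u hu) (hF u hu) 1 0 2 0
  have h2 := frameDeriv_christoffel_sub (fun i => hR i u hu) (hF u hu) 2 0 1 0
  have h3 : frameDeriv R 0 (christoffel R 0 1 2) u = frameDeriv R 0 (christoffel R 0 2 1) u := by
    refine frameDeriv_congr ?_ 0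
    filter_upwards [hΩ.mem_nhds hu] with v hv using (h.christoffel_eq hv).1.symm
  obtain ⟨e1, e2, e3⟩ := h.christoffel_eq hu
  rw [Fin.sum_univ_three] at h1 h2
  rw [h3] at h1
  simp only [e1, e2, e3, hg u hu] at h1 h2 ⊢
  linear_combination h1 - h2

/-- These derivatives make r₁μ = Γ²₂₁ e compatible with the other equations. They come from
curvature identities in which Γ³₂₁ and Γ²₃₁ vanish identically. -/
theorem SingleRelationLambda23.frameDeriv_common (h : SingleRelationLambda23 R Ω) (hΩ : IsOpen Ω)
    (hR : ∀ i, AnalyticOnNhd ℝ (R i) Ω) (hF : IsFrameOn R Ω) (hu : u ∈ Ω)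
    (hg : ∀ u ∈ Ω, christoffel R 2 2 0 u = christoffel R 1 1 0 u) :
    frameDeriv R 1 (christoffel R 1 1 0) u = christoffel R 1 1 0 u * christoffel R 0 1 0 u ∧
    frameDeriv R 2 (christoffel R 1 1 0) u = christoffel R 1 1 0 u * christoffel R 0 2 0 u := by
  have h1 := frameDeriv_christoffel_sub (fun i => hR i u hu) (hF u hu) 1 2 0 2
  have h2 := frameDeriv_christoffel_sub (fun i => hR i u hu) (hF u hu) 2 1 0 1
  have h3 : frameDeriv R 1 (christoffel R 2 2 0) u = frameDeriv R 1 (christoffel R 1 1 0) u := by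
    refine frameDeriv_congr ?_ 1
    filter_upwards [hΩ.mem_nhds hu] with v hv using hg v hv
  have h4 : frameDeriv R 2 (christoffel R 2 1 0) u = 0 := by
    refine frameDeriv_eq_zero ?_ _
    filter_upwards [hΩ.mem_nhds hu] with v hv using (h.christoffel_eq hv).2.2
  have h5 : frameDeriv R 1 (christoffel R 1 2 0) u = 0 := by
    refine frameDeriv_eq_zero ?_ _
    filter_upwards [hΩ.mem_nhds hu] with v hv using (h.christoffel_eq hv).2.1
  obtain ⟨e1, e2, e3⟩ := h.christoffel_eq hu
  rw [Fin.sum_univ_three] at h1 h2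
  rw [h3, h4] at h1
  rw [h5] at h2
  simp only [e1, e2, e3, hg u hu] at h1 h2 ⊢
  constructor
  · linear_combination h1
  · linear_combination h2

end CommonCoefficient

/-! ### Uniqueness and existence of solutions with data on γ. -/

section GeneralSolution

variable {R : Fin 3 → (Fin 3 → ℝ) → (Fin 3 → ℝ)} {Ω : Set (Fin 3 → ℝ)} {p : Fin 3 → ℝ}
  {γ : ℝ → Fin 3 → ℝ}

theorem lambdaSolution_unique (hR : ∀ i, AnalyticOnNhd ℝ (R i) Ω)
    (hF : IsFrameOn R Ω) (h : SingleRelationLambda23 R Ω) (hp : p ∈ Ω) (hγ : AnalyticAt ℝ γ 0)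
    (hγ0 : γ 0 = p) (htr : dualCovector R p 0 ⬝ᵥ deriv γ 0 ≠ 0) {U : Set (Fin 3 → ℝ)}
    (hUo : IsOpen U) (hpU : p ∈ U) (hU : U ⊆ Ω) {lam lam' : (Fin 3 → ℝ) → Fin 3 → ℝ}
    (hl : IsLambdaSolution R U lam) (hl' : IsLambdaSolution R U lam')
    (hcurve : ∀ᶠ t in 𝓝 0, lam (γ t) 0 = lam' (γ t) 0) (hbase : lam p 1 = lam' p 1) :
    ∀ᶠ u in 𝓝 p, lam u = lam' u := by
  have hRp : ∀ i, AnalyticAt ℝ (R i) p := fun i => hR i p hp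
  have hLp := hF p hp
  have hΓ : ∀ k i j, AnalyticAt ℝ (christoffel R k i j) p := analyticAt_christoffel hRp hLp
  -- Only the chart is needed here, so the transport data are zero.
  obtain ⟨Ψ, Θ, hch, -⟩ := exists_isAdaptedChart hRp hLp hγ hγ0 htr
    (analyticAt_const (v := (0 : ℝ))) (analyticAt_const (v := (0 : ℝ)))
    (analyticAt_const (v := (0 : ℝ)))
  have hUp : ∀ᶠ u in 𝓝 p, u ∈ U := hUo.mem_nhds hpU
  let μ : (Fin 3 → ℝ) → ℝ := fun u => lam u 1 - lam' u 1
  let ν : (Fin 3 → ℝ) → ℝ := fun u => lam u 0 - lam' u 0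
  let e : (Fin 3 → ℝ) → ℝ := fun u => ν u - μ u
  have hd : ∀ u ∈ U, ∀ i, DifferentiableAt ℝ (fun v => lam v i) u := fun u hu =>
    hl.differentiableAt_apply hUo hu
  have hd' : ∀ u ∈ U, ∀ i, DifferentiableAt ℝ (fun v => lam' v i) u := fun u hu =>
    hl'.differentiableAt_apply hUo hu
  have hμd : ∀ u ∈ U, DifferentiableAt ℝ μ u := fun u hu => (hd u hu 1).fun_sub (hd' u hu 1)
  have hνd : ∀ u ∈ U, DifferentiableAt ℝ ν u := fun u hu => (hd u hu 0).fun_sub (hd' u hu 0)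
  have hed : ∀ u ∈ U, DifferentiableAt ℝ e u := fun u hu => (hνd u hu).fun_sub (hμd u hu)
  have hrμ : ∀ u ∈ U, frameDeriv R 0 μ u = christoffel R 1 1 0 u * e u ∧
      frameDeriv R 1 μ u = 0 ∧ frameDeriv R 2 μ u = 0 := by
    intro u hu
    obtain ⟨a0, -, a1, a2⟩ := hl.frameDeriv_lambda h hUo hU hu
    obtain ⟨b0, -, b1, b2⟩ := hl'.frameDeriv_lambda h hUo hU hu
    simp only [μ, e, ν, frameDeriv_sub (hd u hu 1) (hd' u hu 1), a0, a1, a2, b0, b1, b2]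
    refine ⟨by ring, by ring, by ring⟩
  have hre : ∀ u ∈ U, frameDeriv R 1 e u = -christoffel R 0 0 1 u * e u ∧
      frameDeriv R 2 e u = -christoffel R 0 0 2 u * e u := by
    intro u hu
    have hν : ∀ k, frameDeriv R k ν u =
        frameDeriv R k (fun v => lam v 0) u - frameDeriv R k (fun v => lam' v 0) u :=
      frameDeriv_sub (hd u hu 0) (hd' u hu 0)
    have he : ∀ k, frameDeriv R k e u = frameDeriv R k ν u - frameDeriv R k μ u :=
      frameDeriv_sub (hνd u hu) (hμd u hu)
    rw [he, he, hν, hν, (hrμ u hu).2.1, (hrμ u hu).2.2,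
      hl.differential u hu 1 0 (by decide), hl.differential u hu 2 0 (by decide),
      hl'.differential u hu 1 0 (by decide), hl'.differential u hu 2 0 (by decide),
      ← hl.lambda_eq h hU hu, ← hl'.lambda_eq h hU hu]
    simp only [e, ν, μ]
    refine ⟨by ring, by ring⟩
  have hγt : Tendsto γ (𝓝 0) (𝓝 p) := hγ0 ▸ hγ.continuousAt.tendsto
  have heγ : ∀ᶠ t in 𝓝 0, e (γ t) = -μ (γ t) := by
    filter_upwards [hcurve] with t ht
    simp only [e, ν, ht, sub_self, zero_sub]
  -- On γ the difference of the λ¹ vanishes, so e = -μ and the equation for μ along γ becomes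
  -- homogeneous and closed.
  have hμγ : ∀ᶠ t in 𝓝 0, μ (γ t) = 0 := by
    refine eventually_eq_zero_of_linear_ode_real
      (B := fun t => (dualCovector R (γ t) 0 ⬝ᵥ deriv γ t) * -christoffel R 1 1 0 (γ t)) ?_
      (hasDerivAt_comp_curve hRp hLp hγ hγ0 (hUp.mono hμd)) ?_ ?_
    · refine (analyticAt_curve_speed hRp hLp hγ hγ0 0).continuousAt.mul ?_
      exact (ContinuousAt.comp (g := christoffel R 1 1 0) (f := γ)
        (hγ0 ▸ (hΓ 1 1 0).continuousAt) hγ.continuousAt).neg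
    · filter_upwards [hγt.eventually hUp, heγ] with t ht het
      obtain ⟨h0, h1, h2⟩ := hrμ _ ht
      rw [Fin.sum_univ_three, h0, h1, h2, het]
      ring
    · simp [μ, hγ0, hbase]
  have hμ0 : ∀ᶠ u in 𝓝 p, μ u = 0 := by
    refine hch.eq_zero_of_curve (A := fun _ => 0) (B := fun _ => 0) (hUp.mono hμd)
      continuousAt_const continuousAt_const (hUp.mono fun u hu => ?_) (hUp.mono fun u hu => ?_) hμγ
    · simp [(hrμ u hu).2.1]
    · simp [(hrμ u hu).2.2]
  have he0 : ∀ᶠ u in 𝓝 p, e u = 0 := by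
    refine hch.eq_zero_of_curve (hUp.mono hed) (hΓ 0 0 1).continuousAt.neg
      (hΓ 0 0 2).continuousAt.neg (hUp.mono fun u hu => (hre u hu).1)
      (hUp.mono fun u hu => (hre u hu).2) ?_
    filter_upwards [heγ, hμγ] with t h1 h2
    rw [h1, h2, neg_zero]
  filter_upwards [hμ0, he0, hUp] with u h1 h2 hu
  have h3 : lam u 1 = lam' u 1 := sub_eq_zero.1 h1
  ext i
  fin_cases i
  · have : ν u = 0 := by simpa [e, h1] using h2
    exact sub_eq_zero.1 this
  · exact h3
  · change lam u 2 = lam' u 2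
    rw [← hl.lambda_eq h hU hu, ← hl'.lambda_eq h hU hu, h3]

/-- The linear differential equation `m' = κ (φ - m)` has an analytic solution. -/
theorem exists_analyticAt_linear_ode {κ φ : ℝ → ℝ} (hκ : AnalyticAt ℝ κ 0)
    (hφ : AnalyticAt ℝ φ 0) (c : ℝ) :
    ∃ m : ℝ → ℝ, AnalyticAt ℝ m 0 ∧ m 0 = c ∧
      ∀ᶠ t in 𝓝 0, HasDerivAt m (κ t * (φ t - m t)) t := by
  -- Time is adjoined as a state variable to make the equation autonomous; `hy1` later recovers that
  -- this variable equals s.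
  have hX : AnalyticAt ℝ (fun z : ℝ × ℝ => ((1 : ℝ), κ z.1 * (φ z.1 - z.2))) (0, c) := by
    have h1 : AnalyticAt ℝ (fun z : ℝ × ℝ => κ z.1) (0, c) :=
      AnalyticAt.comp (g := κ) (f := Prod.fst) hκ analyticAt_fst
    have h2 : AnalyticAt ℝ (fun z : ℝ × ℝ => φ z.1) (0, c) :=
      AnalyticAt.comp (g := φ) (f := Prod.fst) hφ analyticAt_fst
    exact analyticAt_const.prod (h1.mul (h2.sub analyticAt_snd))
  obtain ⟨Φ, hΦ, hΦ0, hΦd⟩ := hX.exists_analyticAt_flow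
  let y : ℝ → ℝ × ℝ := fun s => Φ (s, (0, c))
  have hy : AnalyticAt ℝ y 0 :=
    AnalyticAt.comp (g := Φ) (f := fun s : ℝ => (s, ((0 : ℝ), c))) hΦ
      (analyticAt_id.prod analyticAt_const)
  have hy0 : y 0 = (0, c) := hΦ0.self_of_nhds
  have hyd : ∀ᶠ s in 𝓝 0, HasDerivAt y (1, κ (y s).1 * (φ (y s).1 - (y s).2)) s :=
    ((Continuous.prodMk_left (X := ℝ) (Y := ℝ × ℝ) (0, c)).tendsto' 0 (0, (0, c)) rfl).eventually
      hΦd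
  have hy1 : ∀ᶠ s in 𝓝 0, (y s).1 - s = 0 := by
    refine eventually_eq_zero_of_linear_ode_real (H' := fun _ => 1 - 1) (B := fun _ => 0)
      continuousAt_const ?_ (Eventually.of_forall fun _ => by ring) (by simp [hy0])
    filter_upwards [hyd] with s hs
    have h1 : HasDerivAt (fun s => (y s).1) 1 s := hs.fst
    exact h1.fun_sub (hasDerivAt_id s)
  refine ⟨fun s => (y s).2, analyticAt_snd.comp hy, by simp [hy0], ?_⟩
  filter_upwards [hyd, hy1] with s hs hs1
  have := hs.snd
  rwa [sub_eq_zero.1 hs1] at this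

theorem exists_reduced_solution (hΩ : IsOpen Ω) (hR : ∀ i, AnalyticOnNhd ℝ (R i) Ω)
    (hF : IsFrameOn R Ω) (h : SingleRelationLambda23 R Ω)
    (hg : ∀ u ∈ Ω, christoffel R 2 2 0 u = christoffel R 1 1 0 u) (hp : p ∈ Ω)
    (hγ : AnalyticAt ℝ γ 0) (hγ0 : γ 0 = p) (htr : dualCovector R p 0 ⬝ᵥ deriv γ 0 ≠ 0)
    {φ : ℝ → ℝ} (hφ : AnalyticAt ℝ φ 0) (c : ℝ) :
    ∃ μ e : (Fin 3 → ℝ) → ℝ, AnalyticAt ℝ μ p ∧ AnalyticAt ℝ e p ∧ μ p = c ∧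
      (∀ᶠ t in 𝓝 0, μ (γ t) + e (γ t) = φ t) ∧
      ∀ᶠ u in 𝓝 p, frameDeriv R 0 μ u = christoffel R 1 1 0 u * e u ∧
        frameDeriv R 1 μ u = 0 ∧ frameDeriv R 2 μ u = 0 ∧
        frameDeriv R 1 e u = -christoffel R 0 0 1 u * e u ∧
        frameDeriv R 2 e u = -christoffel R 0 0 2 u * e u := by
  have hRp : ∀ i, AnalyticAt ℝ (R i) p := fun i => hR i p hp
  have hLp := hF p hp
  have hΓ : ∀ u ∈ Ω, ∀ k i j, AnalyticAt ℝ (christoffel R k i j) u := fun u hu =>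
    analyticAt_christoffel (fun i => hR i u hu) (hF u hu)
  have hΩp : ∀ᶠ u in 𝓝 p, u ∈ Ω := hΩ.mem_nhds hp
  have hγt : Tendsto γ (𝓝 0) (𝓝 p) := hγ0 ▸ hγ.continuousAt.tendsto
  have hspeed := analyticAt_curve_speed hRp hLp hγ hγ0 0
  have hκ : AnalyticAt ℝ
      (fun t => (dualCovector R (γ t) 0 ⬝ᵥ deriv γ t) * christoffel R 1 1 0 (γ t)) 0 :=
    hspeed.mul (AnalyticAt.comp (g := christoffel R 1 1 0) (f := γ)
      (hγ0 ▸ hΓ p hp 1 1 0) hγ)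
  -- The restriction of μ to γ is forced: e = φ - m there, and only R₁ contributes to the derivative
  -- of μ along γ.
  obtain ⟨m, hm, hm0, hmd⟩ := exists_analyticAt_linear_ode hκ hφ c
  obtain ⟨Ψ, Θ, hch, W, hW, hWγ, hW1, hW2⟩ := exists_isAdaptedChart hRp hLp hγ hγ0 htr
    (hΓ p hp 0 0 1).neg (hΓ p hp 0 0 2).neg (hφ.sub hm)
  let w : (Fin 3 → ℝ) → ℝ := fun u => (Θ u).1.1
  let e : (Fin 3 → ℝ) → ℝ := fun u => W (Θ u)
  let μ : (Fin 3 → ℝ) → ℝ := fun u => m (w u)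
  have hw : AnalyticAt ℝ w p := analyticAt_fst.comp (analyticAt_fst.comp hch.analyticAt_inv)
  have hwp : w p = 0 := by simp [w, hch.inv_base]
  have he : AnalyticAt ℝ e p :=
    AnalyticAt.comp (g := W) (f := Θ) (by rwa [hch.inv_base]) hch.analyticAt_inv
  have hμ : AnalyticAt ℝ μ p := AnalyticAt.comp (g := m) (f := w) (by rwa [hwp]) hw
  have hwA := hw.eventually_analyticAt
  have heA := he.eventually_analyticAt
  have hμA := hμ.eventually_analyticAt
  have hwt : Tendsto w (𝓝 p) (𝓝 0) := hwp ▸ hw.continuousAt.tendsto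
  have hwΨ : ∀ᶠ q in 𝓝 0, w (Ψ q) = q.1.1 := by
    filter_upwards [hch.inv_apply] with q hq
    simp [w, hq]
  have heΨ : ∀ᶠ q in 𝓝 0, e (Ψ q) = W q := by
    filter_upwards [hch.inv_apply] with q hq
    simp [e, hq]
  have hι : Tendsto (fun t : ℝ => ((t, (0 : ℝ)), (0 : ℝ))) (𝓝 0) (𝓝 0) := by
    have hc : Continuous fun t : ℝ => ((t, (0 : ℝ)), (0 : ℝ)) := by fun_prop
    exact hc.tendsto' 0 0 rfl
  have hj : Tendsto (fun x : ℝ × ℝ => (x, (0 : ℝ))) (𝓝 0) (𝓝 0) :=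
    (Continuous.prodMk_left (X := ℝ × ℝ) (Y := ℝ) 0).tendsto' 0 0 rfl
  have hwγ : ∀ᶠ t in 𝓝 0, w (γ t) = t := by
    filter_upwards [hι.eventually hwΨ, hch.curve] with t h1 h2
    rw [← h2, h1]
  have heγ : ∀ᶠ t in 𝓝 0, e (γ t) = φ t - m t := by
    filter_upwards [hι.eventually heΨ, hch.curve, hWγ] with t h1 h2 h3
    rw [← h2, h1, h3]
    rfl
  have hwd := hwA.mono fun u hu => hu.differentiableAt
  have hed := heA.mono fun u hu => hu.differentiableAt
  -- `w` is a first integral of the distribution spanned by `R₂, R₃`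
  have hw2 : ∀ᶠ u in 𝓝 p, frameDeriv R 2 w u = 0 :=
    hch.eventually_of_comp (hch.frameDeriv_two_eq hwd hwΨ (H' := fun _ => 0)
      (Eventually.of_forall fun q => hasDerivAt_const q.2 q.1.1))
  have hw1s : ∀ᶠ x in 𝓝 (0 : ℝ × ℝ), frameDeriv R 1 w (Ψ (x, 0)) = 0 :=
    hch.frameDeriv_one_eq hwd hwΨ (H' := fun _ => 0)
      (Eventually.of_forall fun x => hasDerivAt_const x.2 x.1)
  -- Since r₃w = 0, the commutator makes r₂w solve a linear equation along R₃, with zero data on the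
  -- surface.
  have hw1 : ∀ᶠ u in 𝓝 p, frameDeriv R 1 w u = 0 := by
    refine hch.eq_zero_of_surface (B := fun u => christoffel R 1 2 1 u - christoffel R 1 1 2 u)
      (analyticAt_frameDeriv hRp hw 1 |>.eventually_analyticAt.mono fun u hu => hu.differentiableAt)
      ((hΓ p hp 1 2 1).continuousAt.sub (hΓ p hp 1 1 2).continuousAt) ?_ hw1s
    filter_upwards [hΩp, hwA, hw2.eventually_nhds] with u hu hwu hw2u
    have h1 := h.commutator hu hR hF hwu
    have h2 : frameDeriv R 1 (frameDeriv R 2 w) u = 0 := frameDeriv_eq_zero hw2u 1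
    rw [h2, hw2u.self_of_nhds] at h1
    linear_combination h1
  have hmdiff : ∀ᶠ u in 𝓝 p, DifferentiableAt ℝ m (w u) :=
    hwt.eventually (hm.eventually_analyticAt.mono fun t ht => ht.differentiableAt)
  have hμ1 : ∀ᶠ u in 𝓝 p, frameDeriv R 1 μ u = 0 := by
    filter_upwards [hmdiff, hwd, hw1] with u h1 h2 h3
    rw [frameDeriv_comp h1 h2, h3, mul_zero]
  have hμ2 : ∀ᶠ u in 𝓝 p, frameDeriv R 2 μ u = 0 := by
    filter_upwards [hmdiff, hwd, hw2] with u h1 h2 h3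
    rw [frameDeriv_comp h1 h2, h3, mul_zero]
  have he2 : ∀ᶠ u in 𝓝 p, frameDeriv R 2 e u = -christoffel R 0 0 2 u * e u := by
    refine hch.eventually_of_comp ?_
    filter_upwards [hch.frameDeriv_two_eq hed heΨ hW2, heΨ] with q h1 h2
    rw [h1, h2]
    rfl
  have he1s : ∀ᶠ x in 𝓝 (0 : ℝ × ℝ), frameDeriv R 1 e (Ψ (x, 0)) =
      -christoffel R 0 0 1 (Ψ (x, 0)) * e (Ψ (x, 0)) := by
    filter_upwards [hch.frameDeriv_one_eq hed heΨ hW1, hj.eventually heΨ] with x h1 h2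
    rw [h1, h2]
    rfl
  have he1 : ∀ᶠ u in 𝓝 p, frameDeriv R 1 e u = -christoffel R 0 0 1 u * e u := by
    -- The R₂-equation for e is built in only on r = 0. Off it, the commutator and `closed` give a
    -- homogeneous linear equation for the defect along R₃.
    have hzero : ∀ᶠ u in 𝓝 p, frameDeriv R 1 e u + christoffel R 0 0 1 u * e u = 0 := by
      refine hch.eq_zero_of_surface (B := fun u => christoffel R 1 2 1 u - christoffel R 1 1 2 u -
        christoffel R 0 0 2 u) ?_ (((hΓ p hp 1 2 1).continuousAt.sub
          (hΓ p hp 1 1 2).continuousAt).sub (hΓ p hp 0 0 2).continuousAt) ?_ ?_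
      · filter_upwards [hΩp, heA] with u hu heu
        exact ((analyticAt_frameDeriv (fun i => hR i u hu) heu 1).add
          ((hΓ u hu 0 0 1).mul heu)).differentiableAt
      · filter_upwards [hΩp, heA, he2.eventually_nhds] with u hu heu he2u
        have hb := (hΓ u hu 0 0 2).differentiableAt
        have ha := (hΓ u hu 0 0 1).differentiableAt
        have hre := (analyticAt_frameDeriv (fun i => hR i u hu) heu 1).differentiableAt
        have h1 := h.commutator hu hR hF heu
        have h2 : frameDeriv R 1 (frameDeriv R 2 e) u =
            -frameDeriv R 1 (christoffel R 0 0 2) u * e u +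
              -christoffel R 0 0 2 u * frameDeriv R 1 e u := by
          rw [frameDeriv_congr he2u, frameDeriv_mul hb.fun_neg heu.differentiableAt]
          simp [frameDeriv, fderiv_fun_neg]
        have h3 := h.closed hΩ hR hF hu hg
        rw [frameDeriv_add hre (ha.fun_mul heu.differentiableAt),
          frameDeriv_mul ha heu.differentiableAt]
        rw [h2, he2u.self_of_nhds] at h1
        rw [he2u.self_of_nhds]
        linear_combination h1 - e u * h3
      · filter_upwards [he1s] with x hx
        rw [hx]
        ring
    filter_upwards [hzero] with u hu
    linear_combination hu
  have hμ0 : ∀ᶠ u in 𝓝 p, frameDeriv R 0 μ u = christoffel R 1 1 0 u * e u := by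
    have hzero : ∀ᶠ u in 𝓝 p, frameDeriv R 0 μ u - christoffel R 1 1 0 u * e u = 0 := by
      have hcomm : ∀ u ∈ Ω, AnalyticAt ℝ μ u → ∀ k, (∀ᶠ v in 𝓝 u, frameDeriv R k μ v = 0) →
          frameDeriv R k (frameDeriv R 0 μ) u =
            ∑ l, (christoffel R l k 0 u - christoffel R l 0 k u) * frameDeriv R l μ u := by
        intro u hu hμu k hk
        have h1 := frameDeriv_frameDeriv_sub (fun i => hR i u hu) (hF u hu) hμu k 0
        have h2 : frameDeriv R 0 (frameDeriv R k μ) u = 0 := frameDeriv_eq_zero hk 0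
        rwa [h2, sub_zero] at h1
      have hexp : ∀ u ∈ Ω, AnalyticAt ℝ μ u → AnalyticAt ℝ e u → ∀ k,
          frameDeriv R k (fun v => frameDeriv R 0 μ v - christoffel R 1 1 0 v * e v) u =
            frameDeriv R k (frameDeriv R 0 μ) u -
              (frameDeriv R k (christoffel R 1 1 0) u * e u +
                christoffel R 1 1 0 u * frameDeriv R k e u) := by
        intro u hu hμu heu k
        have hgd := (hΓ u hu 1 1 0).differentiableAt
        rw [frameDeriv_sub (analyticAt_frameDeriv (fun i => hR i u hu) hμu 0).differentiableAt
          (hgd.fun_mul heu.differentiableAt), frameDeriv_mul hgd heu.differentiableAt]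
      -- In the derivative of r₁μ along R₂ or R₃ only the r₁μ term of the commutator survives; with
      -- `frameDeriv_common` the defect solves homogeneous equations in both directions.
      refine hch.eq_zero_of_curve
        (A := fun u => christoffel R 0 1 0 u - christoffel R 0 0 1 u)
        (B := fun u => christoffel R 0 2 0 u - christoffel R 0 0 2 u) ?_
        ((hΓ p hp 0 1 0).continuousAt.sub (hΓ p hp 0 0 1).continuousAt)
        ((hΓ p hp 0 2 0).continuousAt.sub (hΓ p hp 0 0 2).continuousAt) ?_ ?_ ?_
      · filter_upwards [hΩp, heA, hμA] with u hu heu hμu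
        exact ((analyticAt_frameDeriv (fun i => hR i u hu) hμu 0).sub
          ((hΓ u hu 1 1 0).mul heu)).differentiableAt
      · filter_upwards [hΩp, heA, hμA, hμ1.eventually_nhds, hμ2, he1] with u hu heu hμu h1 h2 h3
        rw [hexp u hu hμu heu, hcomm u hu hμu 1 h1, Fin.sum_univ_three, h1.self_of_nhds, h2, h3,
          (h.frameDeriv_common hΩ hR hF hu hg).1]
        ring
      · filter_upwards [hΩp, heA, hμA, hμ2.eventually_nhds, hμ1, he2] with u hu heu hμu h2 h1 h3
        rw [hexp u hu hμu heu, hcomm u hu hμu 2 h2, Fin.sum_univ_three, h2.self_of_nhds, h1, h3,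
          (h.frameDeriv_common hΩ hR hF hu hg).2]
        ring
      -- On γ the chain rule and the equation for m give (L¹·γ') r₁μ = (L¹·γ') Γ²₂₁ e, and
      -- transversality allows cancelling L¹·γ'.
      · have hne : ∀ᶠ t in 𝓝 0, dualCovector R (γ t) 0 ⬝ᵥ deriv γ t ≠ 0 :=
          hspeed.continuousAt.eventually_ne (by rwa [hγ0])
        filter_upwards [hasDerivAt_comp_curve hRp hLp hγ hγ0
          (hμA.mono fun u hu => hu.differentiableAt), hmd, hwγ.eventually_nhds, heγ, hne,
          hγt.eventually hμ1, hγt.eventually hμ2] with t h1 h2 h3 h4 h5 h6 h7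
        have h8 : (fun s => μ (γ s)) =ᶠ[𝓝 t] m := by
          filter_upwards [h3] with s hs
          simp [μ, hs]
        have h9 := h1.unique (h2.congr_of_eventuallyEq h8)
        rw [Fin.sum_univ_three, h6, h7] at h9
        refine mul_left_cancel₀ h5 ?_
        rw [h4]
        linear_combination h9
    filter_upwards [hzero] with u hu
    exact sub_eq_zero.1 hu
  refine ⟨μ, e, hμ, he, by simp [μ, hwp, hm0], ?_, ?_⟩
  · filter_upwards [hwγ, heγ] with t h1 h2
    simp only [μ, h1, h2]
    ring
  · filter_upwards [hμ0, hμ1, hμ2, he1, he2] with u h0 h1 h2 h3 h4 using ⟨h0, h1, h2, h3, h4⟩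

/-- The converse of the reduction. The coefficient equality enters in the equation for r₁λ³; the
algebraic part follows from `christoffel_eq`. -/
theorem isLambdaSolution_of_reduced {U : Set (Fin 3 → ℝ)} (h : SingleRelationLambda23 R Ω)
    (hU : U ⊆ Ω) (hg : ∀ u ∈ Ω, christoffel R 2 2 0 u = christoffel R 1 1 0 u)
    {μ e : (Fin 3 → ℝ) → ℝ} (hμ : ∀ u ∈ U, DifferentiableAt ℝ μ u)
    (he : ∀ u ∈ U, DifferentiableAt ℝ e u)
    (hr : ∀ u ∈ U, frameDeriv R 0 μ u = christoffel R 1 1 0 u * e u ∧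
      frameDeriv R 1 μ u = 0 ∧ frameDeriv R 2 μ u = 0 ∧
      frameDeriv R 1 e u = -christoffel R 0 0 1 u * e u ∧
      frameDeriv R 2 e u = -christoffel R 0 0 2 u * e u) :
    IsLambdaSolution R U fun u => ![μ u + e u, μ u, μ u] where
  differentiableOn := by
    intro u hu
    refine (differentiableAt_pi.2 fun i => ?_).differentiableWithinAt
    fin_cases i
    · exact (hμ u hu).fun_add (he u hu)
    · exact hμ u hu
    · exact hμ u hu
  differential := by
    intro u hu i j hij
    obtain ⟨h0, h1, h2, h3, h4⟩ := hr u hu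
    have h5 : ∀ k, frameDeriv R k (fun v => μ v + e v) u =
        frameDeriv R k μ u + frameDeriv R k e u := frameDeriv_add (hμ u hu) (he u hu)
    fin_cases i <;> fin_cases j <;> simp at hij ⊢
    · rw [h0]
    · rw [h0, hg u (hU hu)]
    · rw [h5, h1, h3]; ring
    · exact h1
    · rw [h5, h2, h4]; ring
    · exact h2
  algebraic := by
    intro u hu i j k hij hik hjk
    obtain ⟨e1, e2, e3⟩ := h.christoffel_eq (hU hu)
    fin_cases i <;> fin_cases j <;> fin_cases k <;> simp at hij hik hjk ⊢
    · exact Or.inr e3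
    · exact Or.inr e2
    · exact Or.inl e1

theorem dependsOnOneFunctionAndOneConstant (hΩ : IsOpen Ω)
    (hR : ∀ i, AnalyticOnNhd ℝ (R i) Ω) (hF : IsFrameOn R Ω) (h : SingleRelationLambda23 R Ω)
    (hg : ∀ u ∈ Ω, christoffel R 2 2 0 u = christoffel R 1 1 0 u) :
    DependsOnOneFunctionAndOneConstant R Ω := by
  intro p hp γ hγ hγ0 htr
  refine ⟨fun φ c hφ => ?_, fun U hUo hpU hU lam lam' hl hl' hcurve hbase =>
    lambdaSolution_unique hR hF h hp hγ hγ0 htr hUo hpU hU hl hl' hcurve hbase⟩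
  obtain ⟨μ, e, hμ, he, hμp, hcurve, hr⟩ :=
    exists_reduced_solution hΩ hR hF h hg hp hγ hγ0 htr hφ c
  obtain ⟨U, hUsub, hUo, hpU⟩ := eventually_nhds_iff.1
    ((hΩ.eventually_mem hp).and (hμ.eventually_analyticAt.and (he.eventually_analyticAt.and hr)))
  refine ⟨U, hUo, hpU, fun u hu => (hUsub u hu).1, fun u => ![μ u + e u, μ u, μ u],
    isLambdaSolution_of_reduced h (fun u hu => (hUsub u hu).1) hg
      (fun u hu => (hUsub u hu).2.1.differentiableAt)
      (fun u hu => (hUsub u hu).2.2.1.differentiableAt) (fun u hu => (hUsub u hu).2.2.2),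
    fun u hu => analyticAt_pi_iff.2 fun i => ?_, ?_, ?_⟩
  · obtain ⟨-, hμu, heu, -⟩ := hUsub u hu
    fin_cases i
    · exact hμu.add heu
    · exact hμu
    · exact hμu
  · filter_upwards [hcurve] with t ht
    simpa using ht
  · simpa using hμp

end GeneralSolution

theorem mainTheorem4 :
    -- distinct coefficients (on a dense set, e.g. everywhere): only trivial solutions
    (∀ (Ω : Set (Fin 3 → ℝ)) (R : Fin 3 → (Fin 3 → ℝ) → (Fin 3 → ℝ)),
      IsOpen Ω → (∀ i, ContDiffOn ℝ 1 (R i) Ω) → IsFrameOn R Ω → SingleRelationLambda23 R Ω →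
      Ω ⊆ closure {u ∈ Ω | christoffel R 2 2 0 u ≠ christoffel R 1 1 0 u} →
      OnlyTrivialSolutions R Ω) ∧
    -- the analytic alternative: either the two coefficients are not the same function on `Ω` ...
    (∀ (Ω : Set (Fin 3 → ℝ)) (R : Fin 3 → (Fin 3 → ℝ) → (Fin 3 → ℝ)),
      IsOpen Ω → IsPreconnected Ω → (∀ i, AnalyticOnNhd ℝ (R i) Ω) → IsFrameOn R Ω →
      SingleRelationLambda23 R Ω →
      (∃ u ∈ Ω, christoffel R 2 2 0 u ≠ christoffel R 1 1 0 u) →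
      OnlyTrivialSolutions R Ω) ∧
    -- ... or they are
    (∀ (Ω : Set (Fin 3 → ℝ)) (R : Fin 3 → (Fin 3 → ℝ) → (Fin 3 → ℝ)),
      IsOpen Ω → (∀ i, AnalyticOnNhd ℝ (R i) Ω) → IsFrameOn R Ω → SingleRelationLambda23 R Ω →
      (∀ u ∈ Ω, christoffel R 2 2 0 u = christoffel R 1 1 0 u) →
      DependsOnOneFunctionAndOneConstant R Ω) ∧
    -- both situations occur
    (∃ (Ω : Set (Fin 3 → ℝ)) (R : Fin 3 → (Fin 3 → ℝ) → (Fin 3 → ℝ)),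
      IsOpen Ω ∧ Ω.Nonempty ∧ Convex ℝ Ω ∧ (∀ i, AnalyticOnNhd ℝ (R i) Ω) ∧ IsFrameOn R Ω ∧
      SingleRelationLambda23 R Ω ∧
      ∀ u ∈ Ω, christoffel R 2 2 0 u ≠ christoffel R 1 1 0 u) ∧
    (∃ (Ω : Set (Fin 3 → ℝ)) (R : Fin 3 → (Fin 3 → ℝ) → (Fin 3 → ℝ)),
      IsOpen Ω ∧ Ω.Nonempty ∧ Convex ℝ Ω ∧ (∀ i, AnalyticOnNhd ℝ (R i) Ω) ∧ IsFrameOn R Ω ∧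
      SingleRelationLambda23 R Ω ∧
      ∀ u ∈ Ω, christoffel R 2 2 0 u = christoffel R 1 1 0 u) := by
  refine ⟨fun Ω R _ _ hF h hd => onlyTrivialSolutions_of_dense hF h hd,
    fun Ω R hΩ hc hR hF h hne => ?_,
    fun Ω R hΩ hR hF h hg => dependsOnOneFunctionAndOneConstant hΩ hR hF h hg,
    ⟨Set.univ, shearFrame 1, isOpen_univ, Set.univ_nonempty, convex_univ,
      fun i => analyticOnNhd_shearFrame 1 i _, isFrameOn_shearFrame 1 _,
      singleRelation_shearFrame 1 _, fun u _ => ?_⟩,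
    ⟨Set.univ, shearFrame 0, isOpen_univ, Set.univ_nonempty, convex_univ,
      fun i => analyticOnNhd_shearFrame 0 i _, isFrameOn_shearFrame 0 _,
      singleRelation_shearFrame 0 _, fun u _ => ?_⟩⟩
  · have hΓ : ∀ k i j, AnalyticOnNhd ℝ (christoffel R k i j) Ω := fun k i j u hu =>
      analyticAt_christoffel (fun i => hR i u hu) (hF u hu) k i j
    exact onlyTrivialSolutions_of_dense hF h
      (dense_setOf_ne_of_analytic hΩ hc (hΓ 2 2 0) (hΓ 1 1 0) hne)
  · rw [(christoffel_shearFrame 1 u).1, (christoffel_shearFrame 1 u).2]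
    exact one_ne_zero
  · rw [(christoffel_shearFrame 0 u).1, (christoffel_shearFrame 0 u).2]
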